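/- Let $d\ge 1$ and let $\Omega\subset\mathbb R^d$ be a bounded, open, connected, nonempty set with Lipschitz boundary. Let $\partial\Omega=\Gamma_{u,E}\cup\Gamma_{u,N}=\Gamma_{p,E}\cup\Gamma_{p,N}$ be two partitions of the boundary into disjoint measurable parts, where each of $\Gamma_{u,E}$, $\Gamma_{p,E}$ is either empty or of positive surface measure. Let $T>0$, $\mu,\lambda,\alpha,\kappa>0$ and $\sigma\ge 0$ be constants. Write $\|\cdot\|_\Omega$ and $(\cdot,\cdot)_\Omega$ for the norm and scalar product of $L^2(\Omega)$, $H^1_\Gamma(\Omega)$ for the functions in $H^1(\Omega)$ with vanishing trace on $\Gamma$, $L^2_0(\Omega)$ for the functions in $L^2(\Omega)$ with zero mean, $\nabla_S$ for the symmetric gradient and $\mathrm{RM}$ for the rigid body motions. Set $$\mathbb U=\begin{cases}H^1(\Omega)^d/\mathrm{RM}&\text{if }\Gamma_{u,N}=\partial\Omega,\\ H^1_{\Gamma_{u,E}}(\Omega)^d&\text{otherwise,}\end{cases}\qquad \mathbb P=\begin{cases}H^1(\Omega)\cap L^2_0(\Omega)&\text{if }\Gamma_{p,N}=\partial\Omega,\\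 H^1_{\Gamma_{p,E}}(\Omega)\cap L^2_0(\Omega)&\text{if }\Gamma_{p,N}\ne\partial\Omega,\ \Gamma_{u,E}=\partial\Omega,\ \sigma=0,\\ H^1_{\Gamma_{p,E}}(\Omega)&\text{otherwise,}\end{cases}$$ with the norms $\|u\|_{\mathbb U}=\|\sqrt{2\mu}\,\nabla_S u\|_\Omega$ and $\|p\|_{\mathbb P}=\|\sqrt\kappa\,\nabla p\|_\Omega$. Let $\mathbb P^*$ be the dual of $\mathbb P$ with the dual norm, $\mathcal L:\mathbb P\to\mathbb P^*$, $\langle\mathcal Lp,q\rangle=(\kappa\nabla p,\nabla q)_\Omega$, and $\mathcal D=\mathrm{div}:\mathbb U\to L^2(\Omega)$. Let $\mathbb D$ be the range of $\mathcal D$ (a closed subspace of $L^2(\Omega)$), $\overline{\mathbb P}$ the closure of $\mathbb P$ in $L^2(\Omega)$, and $\mathcal P_{\mathbb D}$, $\mathcal P_{\overline{\mathbb P}}$ the $L^2(\Omega)$-orthogonal projections onto them; $q\in\overline{\mathbb P}$ is identified with the functional $(q,\cdot)_\Omega\in\mathbb P^*$. For a Banach space $\mathbb X$ let $L^2(\mathbb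 X)=L^2(0,T;\mathbb X)$ and $H^1(\mathbb X)=H^1(0,T;\mathbb X)$. Define $$\mathbb Y_1=L^2(\mathbb U)\times L^2(\mathbb D)\times L^2(\mathbb P)\times\big(L^2(\overline{\mathbb P})\cap H^1(\mathbb P^*)\big)$$ and, for $y=(u,p_{\rm tot},p,m)\in\mathbb Y_1$, where $m(0)\in\mathbb P^*$ is the value at $0$ of the continuous representative of $m$, $$\begin{aligned}\|y\|_1^2={}&\int_0^T\Big(\|u\|_{\mathbb U}^2+\tfrac1\mu\|p_{\rm tot}\|_\Omega^2+\|\partial_tm+\mathcal Lp\|_{\mathbb P^*}^2\Big)+\|m(0)\|_{\mathbb P^*}^2\\&+\int_0^T\Big(\tfrac1{\mu+\lambda}\|\lambda\mathcal Du-p_{\rm tot}-\alpha\mathcal P_{\mathbb D}p\|_\Omega^2+\gamma\|\alpha\mathcal P_{\overline{\mathbb P}}\mathcal Du+\sigma p-m\|_\Omega^2\Big),\end{aligned}$$ where $\gamma=\min\{\frac{\mu+\lambda}{\alpha^2},\frac1\sigma\}$ if $\sigma>0$ and $\overline{\mathbb P}\subseteq\mathbb D$, $\gamma=\frac{\mu+\lambda}{\alpha^2}+\frac1\sigma$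 if $\sigma>0$ and $\overline{\mathbb P}\not\subseteq\mathbb D$, and $\gamma=\frac{\mu+\lambda}{\alpha^2}$ if $\sigma=0$. Then $$\sup_{y=(u,p_{\rm tot},p,m)\in\mathbb Y_1,\ \|y\|_1\ne0}\ \frac{\int_0^T\big(\|\partial_tm\|_{\mathbb P^*}^2+\|p\|_{\mathbb P}^2\big)}{\|y\|_1^2}=+\infty .$$ Moreover, $\mathbb Y_1$ is not closed with respect to $\|\cdot\|_1$: there is a sequence in $\mathbb Y_1$ that is Cauchy for $\|\cdot\|_1$ and has no limit in $\mathbb Y_1$ for $\|\cdot\|_1$. -/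

import Mathlib

open MeasureTheory Set Filter Topology
open scoped ENNReal NNReal

noncomputable section

namespace Biot

/-! ### Sobolev spaces on an open subset of Euclidean space -/

/-- Euclidean space of dimension `d`. -/
abbrev Space (d : ℕ) : Type := EuclideanSpace ℝ (Fin d)

/-- The space of (classes of) real square integrable functions on `Ω`. -/
abbrev L2 {d : ℕ} (Ω : Set (Space d)) : Type :=
  Lp ℝ 2 ((volume : Measure (Space d)).restrict Ω)

/-- The classical partial derivative in the `i`-th coordinate direction. -/
def pd {d : ℕ} (i : Fin d) (φ : Space d → ℝ) (x : Space d) : ℝ :=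
  fderiv ℝ φ x (EuclideanSpace.single i 1)

/-- Smooth functions with compact support. -/
def IsSmoothCompact {d : ℕ} (φ : Space d → ℝ) : Prop :=
  ContDiff ℝ (⊤ : ℕ∞) φ ∧ HasCompactSupport φ

/-- Smooth functions with compact support contained in `Ω`. -/
def IsTestFunction {d : ℕ} (Ω : Set (Space d)) (φ : Space d → ℝ) : Prop :=
  IsSmoothCompact φ ∧ tsupport φ ⊆ Ω

theorem IsSmoothCompact.continuous_pd {d : ℕ} {φ : Space d → ℝ} (h : IsSmoothCompact φ)
    (i : Fin d) : Continuous (pd i φ) :=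
  (h.1.continuous_fderiv (by simp)).clm_apply continuous_const

theorem IsSmoothCompact.hasCompactSupport_pd {d : ℕ} {φ : Space d → ℝ}
    (h : IsSmoothCompact φ) (i : Fin d) : HasCompactSupport (pd i φ) :=
  (h.2.fderiv ℝ).comp_left (g := fun L : Space d →L[ℝ] ℝ => L (EuclideanSpace.single i 1)) rfl

theorem integrable_mul_of_hasCompactSupport {d : ℕ} {Ω : Set (Space d)} (f : L2 Ω)
    {ψ : Space d → ℝ} (hc : Continuous ψ) (hs : HasCompactSupport ψ) :
    IntegrableOn (fun x => f x * ψ x) Ω :=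
  (Lp.memLp f).integrable_mul
    ((hc.memLp_of_hasCompactSupport (p := 2) (μ := volume) hs).restrict Ω)

/-- `g` is the weak gradient of `f` on `Ω`. -/
def IsWeakGradient {d : ℕ} {Ω : Set (Space d)} (f : L2 Ω) (g : Fin d → L2 Ω) : Prop :=
  ∀ φ : Space d → ℝ, IsTestFunction Ω φ → ∀ i : Fin d,
    ∫ x in Ω, f x * pd i φ x = -∫ x in Ω, g i x * φ x

/-- The Sobolev space `H¹(Ω)`, realized as the set of all pairs `(f, ∇f)` where `f ∈ L²(Ω)` has
the weak gradient `∇f ∈ L²(Ω)^d`. -/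
def h1Submodule {d : ℕ} (Ω : Set (Space d)) : Submodule ℝ (L2 Ω × (Fin d → L2 Ω)) where
  carrier := {w | IsWeakGradient w.1 w.2}
  zero_mem' := by
    intro φ _ i
    have h0 := Lp.coeFn_zero ℝ 2 ((volume : Measure (Space d)).restrict Ω)
    have e1 : ∫ x in Ω, (0 : L2 Ω) x * pd i φ x = 0 :=
      integral_eq_zero_of_ae (h0.mono fun x hx => by
        beta_reduce; rw [hx]; exact zero_mul _)
    have e2 : ∫ x in Ω, (0 : L2 Ω) x * φ x = 0 :=
      integral_eq_zero_of_ae (h0.mono fun x hx => by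
        beta_reduce; rw [hx]; exact zero_mul _)
    simp only [Prod.fst_zero, Prod.snd_zero, Pi.zero_apply, e1, e2, neg_zero]
  add_mem' := by
    intro v w hv hw φ hφ i
    have key : ∀ (a b : L2 Ω) (ψ : Space d → ℝ), Continuous ψ → HasCompactSupport ψ →
        ∫ x in Ω, (a + b) x * ψ x = (∫ x in Ω, a x * ψ x) + ∫ x in Ω, b x * ψ x := by
      intro a b ψ h1 h2
      rw [← integral_add (integrable_mul_of_hasCompactSupport a h1 h2)
        (integrable_mul_of_hasCompactSupport b h1 h2)]
      refine integral_congr_ae ((Lp.coeFn_add a b).mono fun x hx => ?_)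
      simp only [hx, Pi.add_apply, add_mul]
    have h1 := hv φ hφ i
    have h2 := hw φ hφ i
    simp only [Prod.fst_add, Prod.snd_add, Pi.add_apply]
    rw [key _ _ _ (hφ.1.continuous_pd i) (hφ.1.hasCompactSupport_pd i),
      key _ _ _ hφ.1.1.continuous hφ.1.2, h1, h2]
    ring
  smul_mem' := by
    intro c v hv φ hφ i
    have key : ∀ (a : L2 Ω) (ψ : Space d → ℝ),
        ∫ x in Ω, (c • a) x * ψ x = c * ∫ x in Ω, a x * ψ x := by
      intro a ψ
      rw [← integral_const_mul]
      refine integral_congr_ae ((Lp.coeFn_smul c a).mono fun x hx => ?_)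
      simp only [hx, Pi.smul_apply, smul_eq_mul, mul_assoc]
    have h1 := hv φ hφ i
    simp only [Prod.smul_fst, Prod.smul_snd, Pi.smul_apply]
    rw [key, key, h1]
    ring

/-- The Sobolev space `H¹(Ω)`. -/
def H1 {d : ℕ} (Ω : Set (Space d)) : Type := h1Submodule Ω

instance {d : ℕ} (Ω : Set (Space d)) : AddCommGroup (H1 Ω) :=
  inferInstanceAs (AddCommGroup (h1Submodule Ω))
instance {d : ℕ} (Ω : Set (Space d)) : Module ℝ (H1 Ω) :=
  inferInstanceAs (Module ℝ (h1Submodule Ω))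

/-- The function underlying an element of `H¹(Ω)`. -/
def val {d : ℕ} (Ω : Set (Space d)) : H1 Ω →ₗ[ℝ] L2 Ω where
  toFun w := w.1.1
  map_add' _ _ := rfl
  map_smul' _ _ := rfl

/-- The weak partial derivative `∂ᵢ : H¹(Ω) → L²(Ω)`. -/
def weakPd {d : ℕ} (Ω : Set (Space d)) (i : Fin d) : H1 Ω →ₗ[ℝ] L2 Ω where
  toFun w := w.1.2 i
  map_add' _ _ := rfl
  map_smul' _ _ := rfl

theorem isWeakGradient {d : ℕ} {Ω : Set (Space d)} (w : H1 Ω) :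
    IsWeakGradient (val Ω w) (fun i => weakPd Ω i w) := w.2

/-- The surface measure: the `(d-1)`-dimensional Hausdorff measure. -/
def surfaceMeasure (d : ℕ) : Measure (Space d) := Measure.hausdorffMeasure ((d : ℝ) - 1)

/-- The smooth functions `φ n`, restricted to `Ω`, converge to `w` in `H¹(Ω)`, and their
restrictions to `Γ` converge to zero in the `L²`-norm with respect to the surface measure. -/
def ApproximatesWithZeroTrace {d : ℕ} {Ω : Set (Space d)} (Γ : Set (Space d))
    (w : H1 Ω) (φ : ℕ → Space d → ℝ) : Prop :=
  (∀ n, IsSmoothCompact (φ n)) ∧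
  Tendsto (fun n => eLpNorm (fun x => φ n x - val Ω w x) 2 (volume.restrict Ω)) atTop (𝓝 0) ∧
  (∀ i, Tendsto (fun n => eLpNorm (fun x => pd i (φ n) x - weakPd Ω i w x) 2 (volume.restrict Ω))
    atTop (𝓝 0)) ∧
  Tendsto (fun n => eLpNorm (φ n) 2 ((surfaceMeasure d).restrict Γ)) atTop (𝓝 0)

theorem tendsto_eLpNorm_add {d : ℕ} {μ : Measure (Space d)} {f g h : ℕ → Space d → ℝ}
    (hf : ∀ n, AEStronglyMeasurable (f n) μ) (hg : ∀ n, AEStronglyMeasurable (g n) μ)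
    (h1 : Tendsto (fun n => eLpNorm (f n) 2 μ) atTop (𝓝 0))
    (h2 : Tendsto (fun n => eLpNorm (g n) 2 μ) atTop (𝓝 0))
    (hh : ∀ n, h n =ᵐ[μ] f n + g n) :
    Tendsto (fun n => eLpNorm (h n) 2 μ) atTop (𝓝 0) := by
  refine tendsto_of_tendsto_of_tendsto_of_le_of_le tendsto_const_nhds
    (by simpa using h1.add h2) (fun _ => zero_le) (fun n => ?_)
  simp only
  rw [eLpNorm_congr_ae (hh n)]
  exact eLpNorm_add_le (hf n) (hg n) (by norm_num)

theorem tendsto_eLpNorm_smul {d : ℕ} {μ : Measure (Space d)} {f h : ℕ → Space d → ℝ} (c : ℝ)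
    (h1 : Tendsto (fun n => eLpNorm (f n) 2 μ) atTop (𝓝 0))
    (hh : ∀ n, h n =ᵐ[μ] c • f n) :
    Tendsto (fun n => eLpNorm (h n) 2 μ) atTop (𝓝 0) := by
  have e : ∀ n, eLpNorm (h n) 2 μ = ‖c‖ₑ * eLpNorm (f n) 2 μ := fun n => by
    rw [eLpNorm_congr_ae (hh n), eLpNorm_const_smul]
  simp only [e]
  simpa using ENNReal.Tendsto.const_mul h1 (Or.inr (by simp : ‖c‖ₑ ≠ ∞))

theorem pd_add {d : ℕ} {φ ψ : Space d → ℝ} (hφ : IsSmoothCompact φ) (hψ : IsSmoothCompact ψ)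
    (i : Fin d) (x : Space d) : pd i (φ + ψ) x = pd i φ x + pd i ψ x := by
  simp only [pd]
  rw [fderiv_add (hφ.1.differentiable (by simp) x) (hψ.1.differentiable (by simp) x)]
  rfl

theorem pd_smul {d : ℕ} {φ : Space d → ℝ} (c : ℝ) (hφ : IsSmoothCompact φ)
    (i : Fin d) (x : Space d) : pd i (c • φ) x = c * pd i φ x := by
  simp only [pd]
  rw [fderiv_const_smul (hφ.1.differentiable (by simp) x)]
  rfl

/-- The space `H¹_Γ(Ω)` of the functions in `H¹(Ω)` whose trace vanishes almost everywhere on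
`Γ ⊆ ∂Ω`. On a bounded Lipschitz domain the smooth functions are dense in `H¹(Ω)` and the trace is
the continuous extension of the restriction to the boundary, so the trace of `w` vanishes on `Γ` if
and only if smooth functions converging to `w` in `H¹(Ω)` converge to zero in `L²(Γ)`. -/
def H1Zero {d : ℕ} (Ω Γ : Set (Space d)) : Submodule ℝ (H1 Ω) where
  carrier := {w | ∃ φ : ℕ → Space d → ℝ, ApproximatesWithZeroTrace Γ w φ}
  zero_mem' := by
    have h0 := Lp.coeFn_zero ℝ 2 ((volume : Measure (Space d)).restrict Ω)
    have hp : ∀ (i : Fin d) (x : Space d), pd i (fun _ => (0 : ℝ)) x = 0 := fun i x => by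
      simp [pd]
    have e : eLpNorm (fun x => (0 : ℝ) - (0 : L2 Ω) x) 2 (volume.restrict Ω) = 0 := by
      refine (eLpNorm_congr_ae (g := fun _ => (0 : ℝ)) (h0.mono fun x hx => ?_)).trans (by simp)
      beta_reduce; rw [hx]; exact sub_zero _
    refine ⟨fun _ _ => 0, fun _ => ⟨contDiff_const, HasCompactSupport.zero⟩, ?_, fun i => ?_, ?_⟩
    · exact tendsto_const_nhds.congr fun _ => e.symm
    · simp only [hp]
      exact tendsto_const_nhds.congr fun _ => e.symm
    · simp
  add_mem' := by
    rintro v w ⟨φ, h1, h2, h3, h4⟩ ⟨ψ, k1, k2, k3, k4⟩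
    refine ⟨fun n => φ n + ψ n, fun n => ⟨(h1 n).1.add (k1 n).1, (h1 n).2.add (k1 n).2⟩,
      ?_, fun i => ?_, ?_⟩
    · refine tendsto_eLpNorm_add
        (fun n => (h1 n).1.continuous.aestronglyMeasurable.sub (Lp.aestronglyMeasurable _))
        (fun n => (k1 n).1.continuous.aestronglyMeasurable.sub (Lp.aestronglyMeasurable _))
        h2 k2 (fun n => (Lp.coeFn_add (val Ω v) (val Ω w)).mono fun x hx => ?_)
      change φ n x + ψ n x - (val Ω v + val Ω w : L2 Ω) x = (φ n x - val Ω v x) + (ψ n x - val Ω w x)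
      rw [hx, Pi.add_apply]
      ring
    · refine tendsto_eLpNorm_add
        (fun n => ((h1 n).continuous_pd i).aestronglyMeasurable.sub (Lp.aestronglyMeasurable _))
        (fun n => ((k1 n).continuous_pd i).aestronglyMeasurable.sub (Lp.aestronglyMeasurable _))
        (h3 i) (k3 i) (fun n => (Lp.coeFn_add (weakPd Ω i v) (weakPd Ω i w)).mono fun x hx => ?_)
      change pd i (φ n + ψ n) x - (weakPd Ω i v + weakPd Ω i w : L2 Ω) x =
        (pd i (φ n) x - weakPd Ω i v x) + (pd i (ψ n) x - weakPd Ω i w x)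
      rw [hx, Pi.add_apply, pd_add (h1 n) (k1 n)]
      ring
    · exact tendsto_eLpNorm_add (fun n => (h1 n).1.continuous.aestronglyMeasurable)
        (fun n => (k1 n).1.continuous.aestronglyMeasurable) h4 k4 (fun n => EventuallyEq.rfl)
  smul_mem' := by
    rintro c v ⟨φ, h1, h2, h3, h4⟩
    refine ⟨fun n => c • φ n, fun n => ⟨contDiff_const.smul (h1 n).1, (h1 n).2.smul_left⟩,
      ?_, fun i => ?_, ?_⟩
    · refine tendsto_eLpNorm_smul c h2 (fun n => (Lp.coeFn_smul c (val Ω v)).mono fun x hx => ?_)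
      simp only [map_smul, hx, Pi.smul_apply, smul_eq_mul]
      ring
    · refine tendsto_eLpNorm_smul c (h3 i)
        (fun n => (Lp.coeFn_smul c (weakPd Ω i v)).mono fun x hx => ?_)
      simp only [map_smul, hx, Pi.smul_apply, pd_smul c (h1 n),
        smul_eq_mul]
      ring
    · exact tendsto_eLpNorm_smul c h4 (fun n => EventuallyEq.rfl)

/-- The gradient `∇ : H¹(Ω) → L²(Ω)^d`. -/
def grad {d : ℕ} (Ω : Set (Space d)) : H1 Ω →ₗ[ℝ] PiLp 2 (fun _ : Fin d => L2 Ω) where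
  toFun w := WithLp.toLp 2 fun i => weakPd Ω i w
  map_add' _ _ := rfl
  map_smul' _ _ := rfl

/-- Vector-valued Sobolev functions, `H¹(Ω)^d`. -/
abbrev H1Vec {d : ℕ} (Ω : Set (Space d)) : Type := Fin d → H1 Ω

/-- The symmetric gradient `∇_S u = (∇u + ∇uᵀ)/2`; its target carries the `L²`-norm belonging to
the Frobenius norm of matrices. -/
def symGrad {d : ℕ} (Ω : Set (Space d)) :
    H1Vec Ω →ₗ[ℝ] PiLp 2 (fun _ : Fin d × Fin d => L2 Ω) where
  toFun u := WithLp.toLp 2 fun ij =>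
    (1 / 2 : ℝ) • (weakPd Ω ij.2 (u ij.1) + weakPd Ω ij.1 (u ij.2))
  map_add' u v := by
    ext1 ij
    simp only [PiLp.add_apply, Pi.add_apply, map_add, ← smul_add]
    congr 1
    abel
  map_smul' c u := by
    ext1 ij
    simp only [PiLp.smul_apply, Pi.smul_apply, map_smul, ← smul_add, RingHom.id_apply]
    rw [smul_comm]

/-- The divergence `div u = ∑ᵢ ∂ᵢ uᵢ`. -/
def divergence {d : ℕ} (Ω : Set (Space d)) : H1Vec Ω →ₗ[ℝ] L2 Ω where
  toFun u := ∑ i, weakPd Ω i (u i)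
  map_add' u v := by simp only [Pi.add_apply, map_add, Finset.sum_add_distrib]
  map_smul' c u := by
    simp only [Pi.smul_apply, map_smul, Finset.smul_sum, RingHom.id_apply]

/-- Rigid body motions `x ↦ a + B x` with a skew-symmetric matrix `B`, as elements of
`H¹(Ω)^d`. -/
def rigidMotions {d : ℕ} (Ω : Set (Space d)) : Submodule ℝ (H1Vec Ω) where
  carrier := {u | ∃ (a : Fin d → ℝ) (B : Matrix (Fin d) (Fin d) ℝ), B.transpose = -B ∧
    (∀ i, val Ω (u i) =ᵐ[volume.restrict Ω] fun x => a i + ∑ j, B i j * x j) ∧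
    ∀ i j, weakPd Ω j (u i) =ᵐ[volume.restrict Ω] fun _ => B i j}
  zero_mem' := by
    have h0 := Lp.coeFn_zero ℝ 2 ((volume : Measure (Space d)).restrict Ω)
    refine ⟨0, 0, by simp, fun i => ?_, fun i j => ?_⟩
    · rw [Pi.zero_apply, map_zero]
      exact h0.trans (Eventually.of_forall fun x => by simp)
    · rw [Pi.zero_apply, map_zero]
      exact h0
  add_mem' := by
    rintro u v ⟨a, B, h1, h2, h3⟩ ⟨a', B', k1, k2, k3⟩
    refine ⟨a + a', B + B', by rw [Matrix.transpose_add, h1, k1, neg_add], fun i => ?_,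
      fun i j => ?_⟩
    · rw [Pi.add_apply, map_add]
      filter_upwards [h2 i, k2 i, Lp.coeFn_add (val Ω (u i)) (val Ω (v i))] with x e1 e2 e3
      rw [e3, Pi.add_apply, e1, e2]
      simp only [Pi.add_apply, Matrix.add_apply, add_mul, Finset.sum_add_distrib]
      ring
    · rw [Pi.add_apply, map_add]
      filter_upwards [h3 i j, k3 i j, Lp.coeFn_add (weakPd Ω j (u i)) (weakPd Ω j (v i))]
        with x e1 e2 e3
      rw [e3, Pi.add_apply, e1, e2, Matrix.add_apply]
  smul_mem' := by
    rintro c u ⟨a, B, h1, h2, h3⟩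
    refine ⟨c • a, c • B, by rw [Matrix.transpose_smul, h1, smul_neg], fun i => ?_,
      fun i j => ?_⟩
    · rw [Pi.smul_apply, map_smul]
      filter_upwards [h2 i, Lp.coeFn_smul c (val Ω (u i))] with x e1 e2
      rw [e2, Pi.smul_apply, e1]
      simp only [Pi.smul_apply, Matrix.smul_apply, smul_eq_mul, mul_add, Finset.mul_sum,
        mul_assoc]
    · rw [Pi.smul_apply, map_smul]
      filter_upwards [h3 i j, Lp.coeFn_smul c (weakPd Ω j (u i))] with x e1 e2
      rw [e2, Pi.smul_apply, e1, Matrix.smul_apply]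

theorem rigidMotions_le_ker_symGrad {d : ℕ} (Ω : Set (Space d)) :
    rigidMotions Ω ≤ LinearMap.ker (symGrad Ω) := by
  rintro u ⟨a, B, h1, -, h3⟩
  rw [LinearMap.mem_ker]
  ext1 ij
  have hB : B ij.1 ij.2 + B ij.2 ij.1 = 0 := by
    have := congrFun (congrFun h1 ij.2) ij.1
    simp only [Matrix.transpose_apply, Matrix.neg_apply] at this
    linarith
  have : weakPd Ω ij.2 (u ij.1) + weakPd Ω ij.1 (u ij.2) = 0 := by
    apply Lp.ext
    filter_upwards [h3 ij.1 ij.2, h3 ij.2 ij.1,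
      Lp.coeFn_add (weakPd Ω ij.2 (u ij.1)) (weakPd Ω ij.1 (u ij.2)),
      Lp.coeFn_zero ℝ 2 ((volume : Measure (Space d)).restrict Ω)] with x e1 e2 e3 e4
    rw [e3, e4, Pi.add_apply, e1, e2, hB, Pi.zero_apply]
  change (1 / 2 : ℝ) • (weakPd Ω ij.2 (u ij.1) + weakPd Ω ij.1 (u ij.2)) = 0
  rw [this, smul_zero]

theorem rigidMotions_le_ker_divergence {d : ℕ} (Ω : Set (Space d)) :
    rigidMotions Ω ≤ LinearMap.ker (divergence Ω) := by
  rintro u ⟨a, B, h1, -, h3⟩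
  rw [LinearMap.mem_ker]
  change ∑ i, weakPd Ω i (u i) = 0
  refine Finset.sum_eq_zero fun i _ => ?_
  have hB : B i i = 0 := by
    have := congrFun (congrFun h1 i) i
    simp only [Matrix.transpose_apply, Matrix.neg_apply] at this
    linarith
  apply Lp.ext
  filter_upwards [h3 i i,
    Lp.coeFn_zero ℝ 2 ((volume : Measure (Space d)).restrict Ω)] with x e1 e2
  rw [e1, e2, hB, Pi.zero_apply]

/-! ### Domain, boundary parts and material parameters -/

/-- The boundary of `Ω` is locally the graph of a Lipschitz function, with `Ω` on one side: near
every boundary point, for some unit vector `e`, the set `Ω` consists of the points whose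
`e`-coordinate exceeds a Lipschitz function of the component orthogonal to `e`. -/
def HasLipschitzBoundary {d : ℕ} (Ω : Set (Space d)) : Prop :=
  ∀ x ∈ frontier Ω, ∃ (e : Space d) (K : ℝ≥0) (g : Space d → ℝ) (V : Set (Space d)),
    ‖e‖ = 1 ∧ LipschitzWith K g ∧ IsOpen V ∧ x ∈ V ∧
      ∀ y ∈ V, (y ∈ Ω ↔ g (y - inner ℝ e y • e) < inner ℝ e y)

/-- The data of the quasi-static Biot equations in `d` space dimensions: the domain, the parts of
its boundary with essential (`E`) and natural (`N`) boundary conditions for the displacement (`u`)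
and the pressure (`p`), the final time and the material parameters. -/
structure Data (d : ℕ) where
  Ω : Set (Space d)
  isOpen : IsOpen Ω
  isConnected : IsConnected Ω
  isBounded : Bornology.IsBounded Ω
  lipschitz : HasLipschitzBoundary Ω
  ΓuE : Set (Space d)
  ΓuN : Set (Space d)
  ΓpE : Set (Space d)
  ΓpN : Set (Space d)
  union_u : ΓuE ∪ ΓuN = frontier Ω
  disjoint_u : Disjoint ΓuE ΓuN
  union_p : ΓpE ∪ ΓpN = frontier Ω
  disjoint_p : Disjoint ΓpE ΓpN
  measurable_u : MeasurableSet ΓuE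
  measurable_p : MeasurableSet ΓpE
  /-- An essential boundary part is either absent or has positive surface measure. -/
  nonnull_u : ΓuE.Nonempty → 0 < surfaceMeasure d ΓuE
  nonnull_p : ΓpE.Nonempty → 0 < surfaceMeasure d ΓpE
  /-- The final time. -/
  T : ℝ
  T_pos : 0 < T
  /-- The Lamé constants `μ`, `lam`, the Biot-Willis constant `α`, the constrained specific storage
  coefficient `σ` and the hydraulic conductivity `κ`. -/
  μ : ℝ
  lam : ℝ
  α : ℝ
  σ : ℝ
  κ : ℝ
  μ_pos : 0 < μ
  lam_pos : 0 < lam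
  α_pos : 0 < α
  σ_nonneg : 0 ≤ σ
  κ_pos : 0 < κ

namespace Data

variable {d : ℕ} (S : Data d)

instance isFiniteMeasure : IsFiniteMeasure ((volume : Measure (Space d)).restrict S.Ω) :=
  ⟨by simpa using S.isBounded.measure_lt_top⟩

/-! ### The displacement space -/

open Classical in
/-- `H¹(Ω)^d` if `Γ_{u,N} = ∂Ω`, and `H¹_{Γ_{u,E}}(Ω)^d` otherwise. -/
def uSubmodule : Submodule ℝ (H1Vec S.Ω) :=
  if S.ΓuN = frontier S.Ω then ⊤ else Submodule.pi Set.univ fun _ => H1Zero S.Ω S.ΓuE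

open Classical in
/-- The subspace factored out in the definition of the displacement space. -/
def uKernel : Submodule ℝ S.uSubmodule :=
  if S.ΓuN = frontier S.Ω then (rigidMotions S.Ω).comap S.uSubmodule.subtype else ⊥

theorem uKernel_le : S.uKernel ≤ (rigidMotions S.Ω).comap S.uSubmodule.subtype := by
  unfold uKernel
  split_ifs
  · exact le_rfl
  · exact bot_le

/-- The displacement space `𝕌`: the quotient of `H¹(Ω)^d` by the rigid body motions if
`Γ_{u,N} = ∂Ω`, and `H¹_{Γ_{u,E}}(Ω)^d` otherwise. -/
def U : Type := S.uSubmodule ⧸ S.uKernel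

instance : AddCommGroup S.U := inferInstanceAs (AddCommGroup (S.uSubmodule ⧸ S.uKernel))
instance : Module ℝ S.U := inferInstanceAs (Module ℝ (S.uSubmodule ⧸ S.uKernel))

/-- The operator `√(2μ) ∇_S` on `𝕌`. -/
def strain : S.U →ₗ[ℝ] PiLp 2 (fun _ : Fin d × Fin d => L2 S.Ω) :=
  Real.sqrt (2 * S.μ) • S.uKernel.liftQ ((symGrad S.Ω).comp S.uSubmodule.subtype)
    fun _ hu => rigidMotions_le_ker_symGrad S.Ω (S.uKernel_le hu)

/-- The operator `𝒟 = div` on `𝕌`. -/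
def divU : S.U →ₗ[ℝ] L2 S.Ω :=
  S.uKernel.liftQ ((divergence S.Ω).comp S.uSubmodule.subtype)
    fun _ hu => rigidMotions_le_ker_divergence S.Ω (S.uKernel_le hu)

/-- `𝕌` carries `‖u‖_𝕌 = ‖√(2μ) ∇_S u‖_Ω`, which is a norm by Korn's inequality. -/
instance : SeminormedAddCommGroup S.U := SeminormedAddCommGroup.induced _ _ S.strain

instance : NormedSpace ℝ S.U := NormedSpace.induced ℝ _ _ S.strain

/-! ### The pressure space and its dual -/

/-- The elements of `H¹(Ω)` with zero integral mean. -/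
def meanZero : Submodule ℝ (H1 S.Ω) where
  carrier := {w | ∫ x in S.Ω, val S.Ω w x = 0}
  zero_mem' := by
    change ∫ x in S.Ω, val S.Ω 0 x = 0
    rw [map_zero]
    exact integral_eq_zero_of_ae (Lp.coeFn_zero ℝ 2 ((volume : Measure (Space d)).restrict S.Ω))
  add_mem' := by
    intro v w hv hw
    have i1 := (Lp.memLp (val S.Ω v)).integrable (by norm_num)
    have i2 := (Lp.memLp (val S.Ω w)).integrable (by norm_num)
    change ∫ x in S.Ω, val S.Ω v x = 0 at hv
    change ∫ x in S.Ω, val S.Ω w x = 0 at hw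
    change ∫ x in S.Ω, val S.Ω (v + w) x = 0
    rw [map_add, integral_congr_ae (Lp.coeFn_add (val S.Ω v) (val S.Ω w))]
    simp only [Pi.add_apply]
    rw [integral_add i1 i2, hv, hw, add_zero]
  smul_mem' := by
    intro c v hv
    change ∫ x in S.Ω, val S.Ω v x = 0 at hv
    change ∫ x in S.Ω, val S.Ω (c • v) x = 0
    rw [map_smul, integral_congr_ae (Lp.coeFn_smul c (val S.Ω v))]
    simp only [Pi.smul_apply, smul_eq_mul]
    rw [integral_const_mul, hv, mul_zero]

open Classical in
/-- The pressure space as a subspace of `H¹(Ω)`. -/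
def pSubmodule : Submodule ℝ (H1 S.Ω) :=
  if S.ΓpN = frontier S.Ω then S.meanZero
  else if S.ΓuE = frontier S.Ω ∧ S.σ = 0 then H1Zero S.Ω S.ΓpE ⊓ S.meanZero
  else H1Zero S.Ω S.ΓpE

/-- The pressure space `ℙ`. -/
def P : Type := S.pSubmodule

instance : AddCommGroup S.P := inferInstanceAs (AddCommGroup S.pSubmodule)
instance : Module ℝ S.P := inferInstanceAs (Module ℝ S.pSubmodule)

/-- The operator `√κ ∇` on `ℙ`. -/
def pGrad : S.P →ₗ[ℝ] PiLp 2 (fun _ : Fin d => L2 S.Ω) :=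
  Real.sqrt S.κ • (grad S.Ω).comp S.pSubmodule.subtype

/-- The inclusion of `ℙ` in `L²(Ω)`. -/
def pIncl : S.P →ₗ[ℝ] L2 S.Ω := (val S.Ω).comp S.pSubmodule.subtype

/-- `ℙ` carries `‖p‖_ℙ = ‖√κ ∇p‖_Ω`, which is a norm by the Poincaré-Friedrichs inequality. -/
instance : SeminormedAddCommGroup S.P := SeminormedAddCommGroup.induced _ _ S.pGrad

/-- The scalar product `(κ ∇p, ∇q)_Ω` inducing the norm of `ℙ`. -/
instance : InnerProductSpace ℝ S.P where
  __ := NormedSpace.induced ℝ _ _ S.pGrad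
  inner p q := inner ℝ (S.pGrad p) (S.pGrad q)
  norm_sq_eq_re_inner p := norm_sq_eq_re_inner (𝕜 := ℝ) (S.pGrad p)
  conj_inner_symm p q := inner_conj_symm (S.pGrad p) (S.pGrad q)
  add_left p q r := by simp only [map_add, inner_add_left]
  smul_left p q r := by simp only [map_smul, inner_smul_left]

/-- The dual `ℙ*`, with the dual norm of `‖·‖_ℙ`. -/
abbrev PDual : Type := StrongDual ℝ S.P

/-- The elliptic operator `ℒ = -div(κ ∇ ·) : ℙ → ℙ*` in weak form. -/
def diffusion : S.P →L[ℝ] S.PDual := innerSL ℝ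

/-- The weak partial derivative on `ℙ`. -/
def pWeakPd (i : Fin d) : S.P →ₗ[ℝ] L2 S.Ω := (weakPd S.Ω i).comp S.pSubmodule.subtype

theorem diffusion_apply (p q : S.P) :
    S.diffusion p q = S.κ * ∑ i : Fin d, inner ℝ (S.pWeakPd i p) (S.pWeakPd i q) := by
  change inner ℝ (S.pGrad p) (S.pGrad q) = _
  have h : ∀ r : S.P, S.pGrad r = Real.sqrt S.κ • WithLp.toLp 2 fun i => S.pWeakPd i r :=
    fun _ => rfl
  rw [h, h, inner_smul_left, inner_smul_right, ← mul_assoc, PiLp.inner_apply]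
  simp [Real.mul_self_sqrt S.κ_pos.le]

/-! ### The subspaces of `L²(Ω)` for total pressure and total fluid content -/

/-- The space `𝔻 = div 𝕌 ⊆ L²(Ω)`. The range of the divergence is closed in `L²(Ω)`, hence it
coincides with its closure. -/
def D : Submodule ℝ (L2 S.Ω) := (LinearMap.range S.divU).topologicalClosure

/-- The closure of `ℙ` in `L²(Ω)`. -/
def Pbar : Submodule ℝ (L2 S.Ω) := (LinearMap.range S.pIncl).topologicalClosure

instance : CompleteSpace S.D :=
  inferInstanceAs (CompleteSpace (LinearMap.range S.divU).topologicalClosure)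
instance : CompleteSpace S.Pbar :=
  inferInstanceAs (CompleteSpace (LinearMap.range S.pIncl).topologicalClosure)

/-- The `L²(Ω)`-orthogonal projection onto `𝔻`. -/
def projD : L2 S.Ω →L[ℝ] L2 S.Ω := S.D.starProjection

/-- The `L²(Ω)`-orthogonal projection onto the closure of `ℙ`. -/
def projPbar : L2 S.Ω →L[ℝ] L2 S.Ω := S.Pbar.starProjection

open Classical in
/-- The weight `γ` in the trial norm. -/
def gam : ℝ :=
  if 0 < S.σ then
    if S.Pbar ≤ S.D then min ((S.μ + S.lam) / S.α ^ 2) (1 / S.σ)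
    else (S.μ + S.lam) / S.α ^ 2 + 1 / S.σ
  else (S.μ + S.lam) / S.α ^ 2

/-! ### The trial space -/

/-- Lebesgue measure on the time interval. -/
def time : Measure ℝ := volume.restrict (Ioo 0 S.T)

/-- `v` is the weak time derivative on `(0, T)` of the `ℙ*`-valued function `w`: the identity
`∫₀ᵀ φ' w = -∫₀ᵀ φ v` holds in `ℙ*` for all scalar test functions `φ`. The integrals in `ℙ*` are
expressed by evaluation at the elements of `ℙ`. -/
def IsWeakTimeDeriv (w v : ℝ → S.PDual) : Prop :=
  ∀ φ : ℝ → ℝ, ContDiff ℝ (⊤ : ℕ∞) φ → HasCompactSupport φ → tsupport φ ⊆ Ioo 0 S.T →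
    ∀ n : S.P, ∫ t, deriv φ t * w t n ∂S.time = -∫ t, φ t * v t n ∂S.time

/-- The elements of the trial space
`𝕐₁ = L²(𝕌) × L²(𝔻) × L²(ℙ) × (L²(closure of ℙ) ∩ H¹(ℙ*))`, given by representatives defined on
the real line and considered on `(0, T)`. The fourth component `m` comes with the two objects that
it determines, its continuous representative `mc : [0, T] → ℙ*` (here `q ∈ L²(Ω)` is identified with
the functional `(q, ·)_Ω` on `ℙ`) and its weak derivative `dm ∈ L²(ℙ*)`. -/
structure Trial where
  u : ℝ → S.U
  ptot : ℝ → S.D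
  p : ℝ → S.P
  m : ℝ → S.Pbar
  mc : ℝ → S.PDual
  dm : ℝ → S.PDual
  memLp_u : MemLp u 2 S.time
  memLp_ptot : MemLp ptot 2 S.time
  memLp_p : MemLp p 2 S.time
  memLp_m : MemLp m 2 S.time
  memLp_dm : MemLp dm 2 S.time
  continuousOn_mc : ContinuousOn mc (Icc 0 S.T)
  mc_eq : ∀ᵐ t ∂S.time, ∀ n : S.P, mc t n = inner ℝ (m t : L2 S.Ω) (S.pIncl n)
  isWeakTimeDeriv : S.IsWeakTimeDeriv mc dm

variable {S}

theorem memLp_norm {E : Type*} [SeminormedAddCommGroup E] {μ : Measure ℝ} {f : ℝ → E}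
    (hf : MemLp f 2 μ) : MemLp (fun t => ‖f t‖) 2 μ := by
  have e : eLpNorm (fun t => ‖f t‖) 2 μ = eLpNorm f 2 μ :=
    eLpNorm_congr_enorm_ae (Eventually.of_forall fun t => enorm_norm (f t))
  exact ⟨continuous_norm.comp_aestronglyMeasurable hf.1, e ▸ hf.2⟩

theorem memLp_sub {E : Type*} [SeminormedAddCommGroup E] {μ : Measure ℝ} {f g : ℝ → E}
    (hf : MemLp f 2 μ) (hg : MemLp g 2 μ) : MemLp (f - g) 2 μ := by
  refine ⟨hf.1.sub hg.1, lt_of_le_of_lt ?_ ((memLp_norm hf).add (memLp_norm hg)).2⟩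
  refine eLpNorm_mono_enorm fun t => ?_
  exact enorm_le_iff_norm_le.2 ((norm_sub_le _ _).trans (le_abs_self _))

theorem memLp_apply {E : Type*} [SeminormedAddCommGroup E] [NormedSpace ℝ E] {μ : Measure ℝ}
    {v : ℝ → StrongDual ℝ E} (hv : MemLp v 2 μ) (n : E) : MemLp (fun t => v t n) 2 μ := by
  have hc : Continuous fun f : StrongDual ℝ E => f n :=
    ContinuousEvalConst.continuous_eval_const n
  refine ((memLp_norm hv).mul_const ‖n‖).mono (hc.comp_aestronglyMeasurable hv.1)
    (Eventually.of_forall fun t => ?_)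
  exact ((v t).le_opNorm n).trans (le_abs_self _)

theorem integrable_mul_of_continuousOn {w : ℝ → S.PDual} (hw : ContinuousOn w (Icc 0 S.T))
    {ψ : ℝ → ℝ} (hψ : Continuous ψ) (n : S.P) : Integrable (fun t => ψ t * w t n) S.time := by
  have hn : ContinuousOn (fun t => w t n) (Icc 0 S.T) :=
    (ContinuousEvalConst.continuous_eval_const (F := S.PDual) n).comp_continuousOn hw
  have h : IntegrableOn (fun t => ψ t * w t n) (Icc 0 S.T) volume :=
    (hψ.continuousOn.mul hn).integrableOn_Icc
  exact h.mono_set Ioo_subset_Icc_self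

theorem integrable_mul_of_memLp {v : ℝ → S.PDual} (hv : MemLp v 2 S.time)
    {ψ : ℝ → ℝ} (hψ : Continuous ψ) (hs : HasCompactSupport ψ) (n : S.P) :
    Integrable (fun t => ψ t * v t n) S.time := by
  have h1 : MemLp ψ 2 S.time :=
    (hψ.memLp_of_hasCompactSupport (p := 2) (μ := volume) hs).restrict _
  exact h1.integrable_mul (memLp_apply hv n)

instance : Sub S.Trial where
  sub y z :=
    { u := y.u - z.u
      ptot := y.ptot - z.ptot
      p := y.p - z.p
      m := y.m - z.m
      mc := y.mc - z.mc
      dm := y.dm - z.dm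
      memLp_u := memLp_sub y.memLp_u z.memLp_u
      memLp_ptot := memLp_sub y.memLp_ptot z.memLp_ptot
      memLp_p := memLp_sub y.memLp_p z.memLp_p
      memLp_m := memLp_sub y.memLp_m z.memLp_m
      memLp_dm := memLp_sub y.memLp_dm z.memLp_dm
      continuousOn_mc := y.continuousOn_mc.sub z.continuousOn_mc
      mc_eq := by
        filter_upwards [y.mc_eq, z.mc_eq] with t h1 h2 n
        simp only [Pi.sub_apply, sub_apply, h1 n, h2 n,
          AddSubgroupClass.coe_sub, inner_sub_left]
      isWeakTimeDeriv := by
        intro φ h1 h2 h3 n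
        have hd : Continuous (deriv φ) := h1.continuous_deriv (by simp)
        simp only [Pi.sub_apply, sub_apply, mul_sub]
        rw [integral_sub (integrable_mul_of_continuousOn y.continuousOn_mc hd n)
            (integrable_mul_of_continuousOn z.continuousOn_mc hd n),
          integral_sub (integrable_mul_of_memLp y.memLp_dm h1.continuous h2 n)
            (integrable_mul_of_memLp z.memLp_dm h1.continuous h2 n),
          y.isWeakTimeDeriv φ h1 h2 h3 n, z.isWeakTimeDeriv φ h1 h2 h3 n]
        ring }

namespace Trial

/-- The square of the trial norm,
`∫₀ᵀ (‖u‖²_𝕌 + μ⁻¹ ‖p_tot‖²_Ω + ‖∂ₜm + ℒp‖²_ℙ*) + ‖m(0)‖²_ℙ*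
  + ∫₀ᵀ ((μ + λ)⁻¹ ‖λ 𝒟u - p_tot - α 𝒫_𝔻 p‖²_Ω + γ ‖α 𝒫 𝒟u + σ p - m‖²_Ω)`,
where `𝒫` is the projection onto the closure of `ℙ`. -/
def normSq (y : S.Trial) : ℝ≥0∞ :=
  (∫⁻ t, (‖y.u t‖ₑ ^ 2 + ENNReal.ofReal (1 / S.μ) * ‖y.ptot t‖ₑ ^ 2
      + ‖y.dm t + S.diffusion (y.p t)‖ₑ ^ 2) ∂S.time)
    + ‖y.mc 0‖ₑ ^ 2
    + ∫⁻ t, (ENNReal.ofReal (1 / (S.μ + S.lam)) *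
          ‖S.lam • S.divU (y.u t) - (y.ptot t : L2 S.Ω)
            - S.α • S.projD (S.pIncl (y.p t))‖ₑ ^ 2
        + ENNReal.ofReal S.gam *
          ‖S.α • S.projPbar (S.divU (y.u t)) + S.σ • S.pIncl (y.p t)
            - (y.m t : L2 S.Ω)‖ₑ ^ 2) ∂S.time

/-- The quantity `∫₀ᵀ (‖∂ₜm‖²_ℙ* + ‖p‖²_ℙ)`. -/
def roughEnergy (y : S.Trial) : ℝ≥0∞ :=
  ∫⁻ t, (‖y.dm t‖ₑ ^ 2 + ‖y.p t‖ₑ ^ 2) ∂S.time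

end Trial

end Data

end Biot

end

noncomputable section

namespace Biot

/-! ### Smooth functions with compact support -/

section TestFunctions

variable {d : ℕ} {φ ψ : Space d → ℝ} {Ω : Set (Space d)}

/-! The trial norm sees `∂ₜm + ℒp` but neither summand alone. Take `u = 0`, `p_tot = 0` and `m =
-∫₀ᵗ ℒp`: the equation residual and `m(0)` vanish, and what remains is bounded by the `L²(Ω)`-norms
of `p` and `m`. With `p(t) = cos(ωt) q`, the function `m` carries a factor `1/ω` and becomes small
at high frequency. So it suffices to find `q` small in `L²(Ω)` with large gradient; such a `q` is a
derivative `∂ᵢψ` of a concentrated test function (`exists_isTestFunction_pd_small`). Derivatives of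
test functions have mean zero and compact support in `Ω`, so they belong to `ℙ` under all boundary
conditions, and `ℒ∂ᵢψ` is a multiple of a Laplacian of a test function, hence lies in `𝔻` and in the
closure of `ℙ`. Single modes of this kind make the quotient unbounded.

For the failure of closedness, modes `qⱼ` are placed on disjoint open sets, so that they are
orthogonal in `ℙ`, with `‖qⱼ‖_Ω ≤ 2⁻ʲ` and `‖qⱼ‖²_ℙ ≥ j + 1` (`exists_isSpreading`). The partial
sums of `cos(ωⱼt) qⱼ` are Cauchy by comparison with a geometric series. A limit cannot exist because
the trial norm still controls each scalar component `(qⱼ, p)_ℙ` (`Mode.exists_lintegral_inner_le`):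
it equals `-(mⱼ, p)_Ω` with `mⱼ ∈ 𝔻`, so it depends on `𝒫_𝔻 p` only, which is recovered from `u`,
`p_tot` and the residual coupling them. The pressure of a limit would thus have the component
`cos(ωⱼt) ‖qⱼ‖²_ℙ` for every `j`, and Cauchy-Schwarz forces its squared norm in `L²(ℙ)` above `(j +
1) T / 2` for every `j`. -/

theorem IsSmoothCompact.pd (h : IsSmoothCompact φ) (i : Fin d) : IsSmoothCompact (pd i φ) :=
  ⟨(h.1.fderiv_right (m := (⊤ : ℕ∞)) (by simp)).clm_apply contDiff_const,
    h.hasCompactSupport_pd i⟩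

theorem tsupport_pd_subset (i : Fin d) (φ : Space d → ℝ) : tsupport (pd i φ) ⊆ tsupport φ :=
  tsupport_fderiv_apply_subset ℝ (EuclideanSpace.single i 1)

theorem IsTestFunction.pd (h : IsTestFunction Ω φ) (i : Fin d) : IsTestFunction Ω (pd i φ) :=
  ⟨h.1.pd i, (tsupport_pd_subset i φ).trans h.2⟩

theorem IsTestFunction.mono {V : Set (Space d)} (h : IsTestFunction V φ) (hV : V ⊆ Ω) :
    IsTestFunction Ω φ := ⟨h.1, h.2.trans hV⟩

theorem IsTestFunction.eq_zero (h : IsTestFunction Ω φ) {x : Space d} (hx : x ∉ Ω) : φ x = 0 :=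
  image_eq_zero_of_notMem_tsupport fun hx' => hx (h.2 hx')

theorem IsSmoothCompact.integral_mul_pd (hφ : IsSmoothCompact φ) (hψ : IsSmoothCompact ψ)
    (i : Fin d) : ∫ x, φ x * Biot.pd i ψ x = -∫ x, Biot.pd i φ x * ψ x := by
  refine integral_mul_fderiv_eq_neg_fderiv_mul_of_integrable
    (v := EuclideanSpace.single i 1) ?_ ?_ ?_
    (fun x _ => hφ.1.differentiable (by simp) x) (fun x _ => hψ.1.differentiable (by simp) x)
  · exact ((hφ.continuous_pd i).mul hψ.1.continuous).integrable_of_hasCompactSupport hψ.2.mul_left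
  · exact (hφ.1.continuous.mul (hψ.continuous_pd i)).integrable_of_hasCompactSupport hφ.2.mul_right
  · exact (hφ.1.continuous.mul hψ.1.continuous).integrable_of_hasCompactSupport hφ.2.mul_right

/-- Integration by parts against the constant `1`. This is why derivatives of test functions fit the
pressure spaces with a mean value constraint. -/
theorem IsSmoothCompact.integral_pd (hψ : IsSmoothCompact ψ) (i : Fin d) :
    ∫ x, Biot.pd i ψ x = 0 := by
  have h := integral_mul_fderiv_eq_neg_fderiv_mul_of_integrable (μ := (volume : Measure (Space d)))
    (f := fun _ => (1 : ℝ)) (g := ψ)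
    (v := EuclideanSpace.single i 1) (by simp) (by
      simp only [one_mul]
      exact (hψ.continuous_pd i).integrable_of_hasCompactSupport (hψ.pd i).2) (by
      simpa using hψ.1.continuous.integrable_of_hasCompactSupport hψ.2)
    (fun x _ => differentiableAt_const _) (fun x _ => hψ.1.differentiable (by simp) x)
  simp only [one_mul, fderiv_fun_const, Pi.zero_apply, zero_apply, zero_mul,
    integral_zero, neg_zero] at h
  exact h

theorem IsSmoothCompact.memLp (h : IsSmoothCompact φ) (Ω : Set (Space d)) :
    MemLp φ 2 (volume.restrict Ω) :=
  (h.1.continuous.memLp_of_hasCompactSupport h.2).restrict Ω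

/-- The class in `L²(Ω)` of a smooth function with compact support. -/
def IsSmoothCompact.toL2 (h : IsSmoothCompact φ) (Ω : Set (Space d)) : L2 Ω := (h.memLp Ω).toLp φ

theorem IsSmoothCompact.coeFn_toL2 (h : IsSmoothCompact φ) (Ω : Set (Space d)) :
    h.toL2 Ω =ᵐ[volume.restrict Ω] φ := (h.memLp Ω).coeFn_toLp

theorem IsSmoothCompact.inner_toL2 (h : IsSmoothCompact φ) (f : L2 Ω) :
    inner ℝ f (h.toL2 Ω) = ∫ x in Ω, f x * φ x := by
  rw [L2.inner_def]
  refine integral_congr_ae ((h.coeFn_toL2 Ω).mono fun x hx => ?_)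
  simp only [hx]
  simp [mul_comm]

theorem IsTestFunction.inner_toL2 (hφ : IsTestFunction Ω φ) (hψ : IsSmoothCompact ψ) :
    inner ℝ (hφ.1.toL2 Ω) (hψ.toL2 Ω) = ∫ x, φ x * ψ x := by
  rw [hψ.inner_toL2, ← setIntegral_eq_integral_of_forall_compl_eq_zero (s := Ω)
    (f := fun x => φ x * ψ x) (fun x hx => by rw [hφ.eq_zero hx, zero_mul])]
  refine integral_congr_ae ((hφ.1.coeFn_toL2 Ω).mono fun x hx => ?_)
  simp only [hx]

theorem IsSmoothCompact.isWeakGradient (h : IsSmoothCompact φ) (Ω : Set (Space d)) :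
    IsWeakGradient (h.toL2 Ω) fun i => (h.pd i).toL2 Ω := by
  intro χ hχ i
  rw [← (hχ.pd i).1.inner_toL2, ← hχ.1.inner_toL2, real_inner_comm, (hχ.pd i).inner_toL2 h,
    real_inner_comm, hχ.inner_toL2 (h.pd i)]
  have := h.integral_mul_pd hχ.1 i
  simpa only [mul_comm] using this

/-- The element of `H¹(Ω)` given by a smooth function with compact support. -/
def IsSmoothCompact.toH1 (h : IsSmoothCompact φ) (Ω : Set (Space d)) : H1 Ω :=
  ⟨(h.toL2 Ω, fun i => (h.pd i).toL2 Ω), h.isWeakGradient Ω⟩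

theorem IsSmoothCompact.val_toH1 (h : IsSmoothCompact φ) :
    val Ω (h.toH1 Ω) = h.toL2 Ω := rfl

theorem IsSmoothCompact.weakPd_toH1 (h : IsSmoothCompact φ) (i : Fin d) :
    weakPd Ω i (h.toH1 Ω) = (h.pd i).toL2 Ω := rfl

/-- The constant sequence `φ` is an admissible approximation, since `φ` vanishes off `Ω` and hence
on `Γ`. -/
theorem IsTestFunction.toH1_mem_H1Zero (h : IsTestFunction Ω φ) {Γ : Set (Space d)}
    (hΓ : MeasurableSet Γ) (hd : Disjoint Γ Ω) : h.1.toH1 Ω ∈ H1Zero Ω Γ := by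
  refine ⟨fun _ => φ, fun _ => h.1, ?_, fun i => ?_, ?_⟩
  · refine tendsto_const_nhds.congr fun _ => ?_
    rw [IsSmoothCompact.val_toH1]
    refine ((eLpNorm_congr_ae ((h.1.coeFn_toL2 Ω).mono fun x hx => ?_)).trans eLpNorm_zero).symm
    simp [hx]
  · refine tendsto_const_nhds.congr fun _ => ?_
    rw [IsSmoothCompact.weakPd_toH1]
    refine ((eLpNorm_congr_ae (((h.1.pd i).coeFn_toL2 Ω).mono fun x hx => ?_)).trans
      eLpNorm_zero).symm
    simp [hx]
  · refine tendsto_const_nhds.congr fun _ => ?_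
    refine ((eLpNorm_congr_ae ((ae_restrict_iff' hΓ).2 (Eventually.of_forall fun x hx => ?_))).trans
      eLpNorm_zero).symm
    exact h.eq_zero (disjoint_left.1 hd hx)

/-! ### Rescaled bump functions -/

theorem eq_zero_of_pd_eq_zero (h : IsSmoothCompact φ) (i : Fin d) (h0 : ∀ x, pd i φ x = 0) :
    φ = 0 := by
  funext x
  set e : Space d := EuclideanSpace.single i 1 with he
  have hne : ‖e‖ = 1 := by simp [he]
  have hline : ∀ t : ℝ, HasDerivAt (fun t : ℝ => x + t • e) e t := fun t => by
    simpa using ((hasDerivAt_id t).smul_const e).const_add x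
  have hder : ∀ t : ℝ, HasDerivAt (fun t : ℝ => φ (x + t • e)) 0 t := fun t => by
    have := (h.1.differentiable (by simp) (x + t • e)).hasFDerivAt.comp_hasDerivAt t (hline t)
    rwa [show fderiv ℝ φ (x + t • e) e = 0 from h0 _] at this
  obtain ⟨R, hR⟩ := h.2.isCompact.isBounded.subset_closedBall (0 : Space d)
  -- Along the line through `x` in direction `e` the function is constant; this parameter value
  -- moves `x` outside the ball of radius `R` that contains the support.
  have hc := is_const_of_deriv_eq_zero (fun t => (hder t).differentiableAt)
    (fun t => (hder t).deriv) 0 (‖x‖ + |R| + 1)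
  simp only [zero_smul, add_zero] at hc
  rw [hc]
  refine image_eq_zero_of_notMem_tsupport fun hx => ?_
  have h1 := hR hx
  rw [mem_closedBall_zero_iff] at h1
  have h2 : ‖(‖x‖ + |R| + 1) • e‖ = ‖x‖ + |R| + 1 := by
    rw [norm_smul, hne, mul_one, Real.norm_of_nonneg (by positivity)]
  have h3 := norm_sub_norm_le ((‖x‖ + |R| + 1) • e) (-x)
  rw [h2, norm_neg, sub_neg_eq_add, add_comm _ x] at h3
  linarith [le_abs_self R]

theorem IsSmoothCompact.integrable_sq (h : IsSmoothCompact φ) : Integrable fun x => φ x ^ 2 := by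
  simp only [sq]
  exact (h.1.continuous.mul h.1.continuous).integrable_of_hasCompactSupport h.2.mul_left

theorem IsSmoothCompact.integral_sq_pos (h : IsSmoothCompact φ) (h0 : φ ≠ 0) :
    0 < ∫ x, φ x ^ 2 := by
  obtain ⟨x, hx⟩ := Function.ne_iff.1 h0
  exact integral_pos_of_integrable_nonneg_nonzero (x := x) (h.1.continuous.pow 2) h.integrable_sq
    (fun x => sq_nonneg (φ x)) (pow_ne_zero 2 hx)

theorem pd_scale (h : IsSmoothCompact φ) (i : Fin d) (c s : ℝ) (x₀ x : Space d) :
    pd i (fun y => c * φ (s • (y - x₀))) x = c * s * pd i φ (s • (x - x₀)) := by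
  have h1 : HasFDerivAt (fun y : Space d => s • (y - x₀)) (s • ContinuousLinearMap.id ℝ _) x :=
    ((hasFDerivAt_id x).sub_const x₀).const_smul s
  have h2 := ((h.1.differentiable (by simp) (s • (x - x₀))).hasFDerivAt.comp x h1).const_mul c
  have h3 : fderiv ℝ (fun y => c * φ (s • (y - x₀))) x = _ := h2.fderiv
  simp only [pd]
  rw [h3]
  simp [mul_assoc]

theorem integral_sq_scale (g : Space d → ℝ) (c s : ℝ) (x₀ : Space d) :
    ∫ x, (c * g (s • (x - x₀))) ^ 2 = c ^ 2 * |(s ^ d)⁻¹| * ∫ x, g x ^ 2 := by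
  have h1 := integral_sub_right_eq_self (μ := (volume : Measure (Space d)))
    (fun x => (c * g (s • x)) ^ 2) x₀
  rw [h1]
  have h2 := Measure.integral_comp_smul (volume : Measure (Space d)) (fun x => g x ^ 2) s
  simp only [mul_pow]
  rw [integral_const_mul, h2]
  simp [mul_assoc]

/-- A test function with small first and large second derivative in a coordinate direction. -/
theorem exists_isTestFunction_pd_small (i : Fin d) {V : Set (Space d)} (hV : IsOpen V)
    (hne : V.Nonempty) {ε : ℝ} (hε : 0 < ε) (C : ℝ) :
    ∃ ψ, IsTestFunction V ψ ∧ ∫ x, pd i ψ x ^ 2 ≤ ε ∧ C ≤ ∫ x, pd i (pd i ψ) x ^ 2 := by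
  obtain ⟨x₀, hx₀⟩ := hne
  obtain ⟨r, hr, hrV⟩ := Metric.isOpen_iff.1 hV x₀ hx₀
  let b : ContDiffBump (0 : Space d) := ⟨1, 2, one_pos, one_lt_two⟩
  have hb : IsSmoothCompact (b : Space d → ℝ) := ⟨b.contDiff, b.hasCompactSupport⟩
  set A := ∫ x, pd i b x ^ 2
  set B := ∫ x, pd i (pd i b) x ^ 2 with hB
  have hA : 0 ≤ A := integral_nonneg fun x => sq_nonneg _
  have hBpos : 0 < B := by
    refine ((hb.pd i).pd i).integral_sq_pos fun h0 => ?_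
    have h1 := eq_zero_of_pd_eq_zero (hb.pd i) i (fun x => congrFun h0 x)
    have h2 := eq_zero_of_pd_eq_zero hb i (fun x => congrFun h1 x)
    have h3 : b 0 = 1 := b.one_of_mem_closedBall (by simp [b])
    rw [h2] at h3
    simp at h3
  -- The bump has outer radius `2`, so `2 / r < s` makes the rescaled support fit into the ball of
  -- radius `r`; the last bound makes the second derivative large.
  obtain ⟨s, hs1, hsr, hsC⟩ : ∃ s : ℝ, 1 ≤ s ∧ 2 / r < s ∧ C * (A + 1) / (ε * B) ≤ s := by
    refine ⟨max 1 (max (2 / r + 1) (C * (A + 1) / (ε * B))), le_max_left _ _, ?_, ?_⟩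
    · exact (lt_add_one _).trans_le ((le_max_left _ _).trans (le_max_right _ _))
    · exact (le_max_right _ _).trans (le_max_right _ _)
  have hs : 0 < s := one_pos.trans_le hs1
  -- The amplitude normalizes the first derivative to `ε * A / (A + 1)` independently of `s`, while
  -- the second becomes `ε * B / (A + 1) * s ^ 2`. The `+ 1` keeps the denominator positive without
  -- knowing `A ≠ 0`.
  set c := Real.sqrt (ε / (A + 1) * s ^ d / s ^ 2) with hc
  have hc2 : c ^ 2 = ε / (A + 1) * s ^ d / s ^ 2 := Real.sq_sqrt (by positivity)
  have hsd : |(s ^ d)⁻¹| = (s ^ d)⁻¹ := abs_of_pos (by positivity)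
  let ψ : Space d → ℝ := fun x => c * b (s • (x - x₀))
  have e1 : pd i ψ = fun x => c * s * pd i b (s • (x - x₀)) :=
    funext fun x => pd_scale hb i c s x₀ x
  have e2 : pd i (pd i ψ) = fun x => c * s * s * pd i (pd i b) (s • (x - x₀)) := by
    rw [e1]
    exact funext fun x => pd_scale (hb.pd i) i (c * s) s x₀ x
  have hsupp : tsupport ψ ⊆ Metric.closedBall x₀ (2 / s) := by
    refine closure_minimal (fun x hx => ?_) Metric.isClosed_closedBall
    have hx' : b (s • (x - x₀)) ≠ 0 := right_ne_zero_of_mul hx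
    have h1 : s • (x - x₀) ∈ Function.support b := hx'
    rw [b.support_eq, mem_ball_zero_iff, norm_smul, Real.norm_of_nonneg hs.le] at h1
    rw [Metric.mem_closedBall, dist_eq_norm, le_div_iff₀ hs]
    have : s * ‖x - x₀‖ < 2 := h1
    linarith
  refine ⟨ψ, ⟨⟨?_, ?_⟩, ?_⟩, ?_, ?_⟩
  · exact contDiff_const.mul (b.contDiff.comp ((contDiff_id.sub contDiff_const).const_smul s))
  · exact (isCompact_closedBall x₀ (2 / s)).of_isClosed_subset (isClosed_tsupport _) hsupp
  · refine hsupp.trans ((Metric.closedBall_subset_ball ?_).trans hrV)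
    rw [div_lt_comm₀ hs hr]
    exact hsr
  · rw [e1, integral_sq_scale, hsd]
    have : (c * s) ^ 2 * (s ^ d)⁻¹ * A = ε * (A / (A + 1)) := by
      rw [mul_pow, hc2]; field_simp
    rw [this]
    exact mul_le_of_le_one_right hε.le ((div_le_one (by positivity)).2 (by linarith))
  · rw [e2, integral_sq_scale, hsd, ← hB]
    have : (c * s * s) ^ 2 * (s ^ d)⁻¹ * B = ε * B / (A + 1) * s ^ 2 := by
      rw [mul_pow, mul_pow, hc2]; field_simp
    rw [this]
    rw [div_le_iff₀ (by positivity)] at hsC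
    have h2 : C ≤ ε * B / (A + 1) * s := by
      rw [div_mul_eq_mul_div, le_div_iff₀ (by positivity)]
      linarith
    refine h2.trans (mul_le_mul_of_nonneg_left ?_ (by positivity))
    nlinarith

end TestFunctions

namespace Data

variable {d : ℕ} (S : Data d)

/-! ### Test functions as elements of the trial spaces -/

theorem disjoint_frontier : Disjoint (frontier S.Ω) S.Ω :=
  disjoint_frontier_iff_isOpen.2 S.isOpen

variable {S} {φ ψ : Space d → ℝ}

theorem toH1_mem_H1Zero_p (h : IsTestFunction S.Ω φ) : h.1.toH1 S.Ω ∈ H1Zero S.Ω S.ΓpE :=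
  h.toH1_mem_H1Zero S.measurable_p
    (S.disjoint_frontier.mono_left (S.union_p ▸ subset_union_left))

theorem toH1_mem_H1Zero_u (h : IsTestFunction S.Ω φ) : h.1.toH1 S.Ω ∈ H1Zero S.Ω S.ΓuE :=
  h.toH1_mem_H1Zero S.measurable_u
    (S.disjoint_frontier.mono_left (S.union_u ▸ subset_union_left))

theorem toH1_pd_mem_meanZero (h : IsTestFunction S.Ω ψ) (i : Fin d) :
    (h.pd i).1.toH1 S.Ω ∈ S.meanZero := by
  change ∫ x in S.Ω, (h.pd i).1.toL2 S.Ω x = 0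
  rw [integral_congr_ae ((h.pd i).1.coeFn_toL2 S.Ω),
    setIntegral_eq_integral_of_forall_compl_eq_zero fun x hx => (h.pd i).eq_zero hx]
  exact h.1.integral_pd i

/-- Zero trace and zero mean both hold, so every case in the definition of the pressure space is
covered. -/
theorem toH1_pd_mem_pSubmodule (h : IsTestFunction S.Ω ψ) (i : Fin d) :
    (h.pd i).1.toH1 S.Ω ∈ S.pSubmodule := by
  unfold pSubmodule
  split_ifs
  · exact toH1_pd_mem_meanZero h i
  · exact ⟨toH1_mem_H1Zero_p (h.pd i), toH1_pd_mem_meanZero h i⟩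
  · exact toH1_mem_H1Zero_p (h.pd i)

theorem toH1_mem_uSubmodule {v : Fin d → Space d → ℝ} (h : ∀ i, IsTestFunction S.Ω (v i)) :
    (fun i => (h i).1.toH1 S.Ω) ∈ S.uSubmodule := by
  unfold uSubmodule
  split_ifs
  · exact Submodule.mem_top
  · exact fun i _ => toH1_mem_H1Zero_u (h i)

/-- The pressure given by a derivative of a test function. -/
def pressureOfPd (h : IsTestFunction S.Ω ψ) (i : Fin d) : S.P :=
  ⟨(h.pd i).1.toH1 S.Ω, toH1_pd_mem_pSubmodule h i⟩

theorem pIncl_pressureOfPd (h : IsTestFunction S.Ω ψ) (i : Fin d) :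
    S.pIncl (pressureOfPd h i) = (h.pd i).1.toL2 S.Ω := rfl

theorem pWeakPd_pressureOfPd (h : IsTestFunction S.Ω ψ) (i j : Fin d) :
    S.pWeakPd j (pressureOfPd h i) = ((h.pd i).pd j).1.toL2 S.Ω := rfl

/-! ### Laplacians of test functions and the scalar product of `ℙ` -/

/-- The class of the Laplacian of a test function. -/
def laplacian (h : IsTestFunction S.Ω φ) : L2 S.Ω := ∑ i, ((h.pd i).pd i).1.toL2 S.Ω

/-- The Laplacian is the divergence of the gradient, whose components are test functions and so form
an admissible displacement. -/
theorem laplacian_mem_D (h : IsTestFunction S.Ω φ) : laplacian h ∈ S.D :=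
  Submodule.le_topologicalClosure _
    ⟨S.uKernel.mkQ ⟨_, toH1_mem_uSubmodule fun i => h.pd i⟩, rfl⟩

/-- Each summand is itself a derivative of a test function, hence a pressure, also under a mean
value constraint. -/
theorem laplacian_mem_Pbar (h : IsTestFunction S.Ω φ) : laplacian h ∈ S.Pbar :=
  Submodule.sum_mem _ fun i _ => Submodule.le_topologicalClosure _ ⟨pressureOfPd (h.pd i) i, rfl⟩

theorem inner_eq_diffusion (p q : S.P) : inner ℝ p q = S.diffusion p q := rfl

theorem inner_laplacian (h : IsTestFunction S.Ω φ) (q : S.P) :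
    inner ℝ (laplacian h) (S.pIncl q) =
      -∑ j, inner ℝ ((h.pd j).1.toL2 S.Ω) (S.pWeakPd j q) := by
  rw [laplacian, sum_inner, ← Finset.sum_neg_distrib]
  refine Finset.sum_congr rfl fun j _ => ?_
  rw [real_inner_comm, IsSmoothCompact.inner_toL2, real_inner_comm, IsSmoothCompact.inner_toL2]
  exact Biot.isWeakGradient q.1 _ (h.pd j) j

/-- Integration by parts without boundary term, by the weak gradient of `q`. It turns a component in
`ℙ` into an `L²(Ω)` pairing with an element of `𝔻`. -/
theorem inner_pressureOfPd (h : IsTestFunction S.Ω ψ) (i : Fin d) (q : S.P) :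
    inner ℝ (pressureOfPd h i) q = -inner ℝ (S.κ • laplacian (h.pd i)) (S.pIncl q) := by
  rw [inner_eq_diffusion, diffusion_apply, inner_smul_left, inner_laplacian]
  simp [pWeakPd_pressureOfPd]

theorem le_norm_sq_pressureOfPd (h : IsTestFunction S.Ω ψ) (i : Fin d) :
    S.κ * ∫ x, pd i (pd i ψ) x ^ 2 ≤ ‖pressureOfPd h i‖ ^ 2 := by
  rw [← real_inner_self_eq_norm_sq, inner_eq_diffusion, diffusion_apply]
  refine mul_le_mul_of_nonneg_left ?_ S.κ_pos.le
  refine le_trans (le_of_eq ?_)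
    (Finset.single_le_sum (fun j _ => real_inner_self_nonneg) (Finset.mem_univ i))
  rw [pWeakPd_pressureOfPd, ((h.pd i).pd i).inner_toL2]
  simp only [sq]

theorem norm_sq_pIncl_pressureOfPd (h : IsTestFunction S.Ω ψ) (i : Fin d) :
    ‖S.pIncl (pressureOfPd h i)‖ ^ 2 = ∫ x, pd i ψ x ^ 2 := by
  rw [← real_inner_self_eq_norm_sq, pIncl_pressureOfPd, (h.pd i).inner_toL2]
  simp only [sq]

theorem inner_pressureOfPd_of_disjoint {V W : Set (Space d)} (hVW : Disjoint V W)
    (hφ : IsTestFunction S.Ω φ) (hψ : IsTestFunction S.Ω ψ) (hV : IsTestFunction V φ)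
    (hW : IsTestFunction W ψ) (i : Fin d) :
    inner ℝ (pressureOfPd hφ i) (pressureOfPd hψ i) = 0 := by
  rw [inner_eq_diffusion, diffusion_apply]
  simp only [pWeakPd_pressureOfPd]
  rw [Finset.sum_eq_zero, mul_zero]
  intro j _
  rw [((hφ.pd i).pd j).inner_toL2]
  refine integral_eq_zero_of_ae (Eventually.of_forall fun x => ?_)
  by_cases hx : x ∈ V
  · simp [((hW.pd i).pd j).eq_zero (disjoint_left.1 hVW hx)]
  · simp [((hV.pd i).pd j).eq_zero hx]

/-! ### Control of the pressure by the trial norm -/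

/-- The divergence is the trace of the symmetric gradient, and each of the `d` diagonal entries is
bounded by the full norm. No Korn inequality is involved. -/
theorem norm_divU_le (u : S.U) : ‖S.divU u‖ ≤ d / Real.sqrt (2 * S.μ) * ‖u‖ := by
  obtain ⟨v, hv⟩ := S.uKernel.mkQ_surjective u
  have hμ : 0 < Real.sqrt (2 * S.μ) := Real.sqrt_pos.2 (by linarith [S.μ_pos])
  set G := symGrad S.Ω v.1 with hG
  have h1 : ‖u‖ = Real.sqrt (2 * S.μ) * ‖G‖ := by
    have h0 : S.strain u = Real.sqrt (2 * S.μ) • G := by subst hv; rfl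
    change ‖S.strain u‖ = _
    rw [h0, norm_smul, Real.norm_of_nonneg hμ.le]
  have h2 : S.divU u = ∑ i, G (i, i) := by
    have h0 : S.divU u = ∑ i, weakPd S.Ω i (v.1 i) := by subst hv; rfl
    rw [h0]
    refine Finset.sum_congr rfl fun i _ => ?_
    change _ = (1 / 2 : ℝ) • (weakPd S.Ω i (v.1 i) + weakPd S.Ω i (v.1 i))
    rw [← two_smul ℝ, smul_smul]
    norm_num
  rw [h1, h2]
  calc ‖∑ i, G (i, i)‖ ≤ ∑ i : Fin d, ‖G (i, i)‖ := norm_sum_le _ _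
    _ ≤ ∑ _i : Fin d, ‖G‖ := Finset.sum_le_sum fun i _ => PiLp.norm_apply_le G (i, i)
    _ = d * ‖G‖ := by simp
    _ = _ := by field_simp

theorem enorm_sq_eq_ofReal {E : Type*} [SeminormedAddGroup E] (x : E) :
    ‖x‖ₑ ^ 2 = ENNReal.ofReal (‖x‖ ^ 2) := by
  rw [← ofReal_norm, ENNReal.ofReal_pow (norm_nonneg x)]

theorem aemeasurable_enorm_sq {E : Type*} [SeminormedAddCommGroup E] {μ : Measure ℝ} {f : ℝ → E}
    (hf : MemLp f 2 μ) : AEMeasurable (fun t => ‖f t‖ₑ ^ 2) μ :=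
  hf.1.enorm.pow_const 2

/-- Pairing with `g ∈ 𝔻` sees only `𝒫_𝔻 q`, and `α 𝒫_𝔻 q` is `λ 𝒟u - r` minus the residual; each of
the three terms occurs in the trial norm. -/
theorem inner_sq_le_of_mem_D {g : L2 S.Ω} (hg : g ∈ S.D) (u : S.U) (r : L2 S.Ω) (q : L2 S.Ω) :
    inner ℝ g q ^ 2 ≤ 3 * ‖g‖ ^ 2 / S.α ^ 2 *
        (S.lam ^ 2 * (d / Real.sqrt (2 * S.μ)) ^ 2 + S.μ + (S.μ + S.lam)) *
      (‖u‖ ^ 2 + 1 / S.μ * ‖r‖ ^ 2 +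
        1 / (S.μ + S.lam) * ‖S.lam • S.divU u - r - S.α • S.projD q‖ ^ 2) := by
  set R := S.lam • S.divU u - r - S.α • S.projD q with hR
  set c := d / Real.sqrt (2 * S.μ)
  have hμ := S.μ_pos
  have hl := S.lam_pos
  have hα := S.α_pos
  have h1 : inner ℝ g q = inner ℝ g (S.projD q) := by
    conv_lhs => rw [← Submodule.starProjection_eq_self_iff.2 hg]
    exact Submodule.inner_starProjection_left_eq_right _ _ _
  have h2 : S.α • S.projD q = S.lam • S.divU u - r - R := by rw [hR]; abel
  have h3 : S.α * |inner ℝ g q| ≤ ‖g‖ * (S.lam * (c * ‖u‖) + ‖r‖ + ‖R‖) := by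
    calc S.α * |inner ℝ g q| = |inner ℝ g (S.lam • S.divU u - r - R)| := by
          rw [← h2, inner_smul_right, abs_mul, abs_of_pos hα, h1]
      _ ≤ ‖g‖ * ‖S.lam • S.divU u - r - R‖ := abs_real_inner_le_norm _ _
      _ ≤ ‖g‖ * (S.lam * (c * ‖u‖) + ‖r‖ + ‖R‖) := by
          gcongr
          refine (norm_sub_le _ _).trans (add_le_add_left ((norm_sub_le _ _).trans ?_) _)
          rw [norm_smul, Real.norm_of_nonneg hl.le]
          gcongr
          exact norm_divU_le u
  have h4 : S.α ^ 2 * inner ℝ g q ^ 2 ≤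
      ‖g‖ ^ 2 * (3 * (S.lam ^ 2 * c ^ 2 * ‖u‖ ^ 2 + ‖r‖ ^ 2 + ‖R‖ ^ 2)) := by
    have h5 := pow_le_pow_left₀ (by positivity) h3 2
    rw [mul_pow, sq_abs, mul_pow] at h5
    refine h5.trans (mul_le_mul_of_nonneg_left ?_ (sq_nonneg _))
    -- This is `(a + b + c)² ≤ 3 (a² + b² + c²)`, the source of the factor `3`.
    nlinarith [sq_nonneg (S.lam * (c * ‖u‖) - ‖r‖), sq_nonneg (S.lam * (c * ‖u‖) - ‖R‖),
      sq_nonneg (‖r‖ - ‖R‖)]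
  have h6 : S.lam ^ 2 * c ^ 2 * ‖u‖ ^ 2 + ‖r‖ ^ 2 + ‖R‖ ^ 2 ≤
      (S.lam ^ 2 * c ^ 2 + S.μ + (S.μ + S.lam)) *
        (‖u‖ ^ 2 + 1 / S.μ * ‖r‖ ^ 2 + 1 / (S.μ + S.lam) * ‖R‖ ^ 2) := by
    have e1 : ‖r‖ ^ 2 = S.μ * (1 / S.μ * ‖r‖ ^ 2) := by field_simp
    have e2 : ‖R‖ ^ 2 = (S.μ + S.lam) * (1 / (S.μ + S.lam) * ‖R‖ ^ 2) := by field_simp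
    have p1 : 0 ≤ 1 / S.μ * ‖r‖ ^ 2 := by positivity
    have p2 : 0 ≤ 1 / (S.μ + S.lam) * ‖R‖ ^ 2 := by positivity
    have p3 : 0 ≤ S.lam ^ 2 * c ^ 2 := by positivity
    have p4 : 0 ≤ ‖u‖ ^ 2 := by positivity
    nth_rewrite 1 [e1, e2]
    generalize 1 / S.μ * ‖r‖ ^ 2 = X at *
    generalize 1 / (S.μ + S.lam) * ‖R‖ ^ 2 = Y at *
    generalize S.lam ^ 2 * c ^ 2 = Z at *
    nlinarith [mul_nonneg p3 p1, mul_nonneg p3 p2, mul_nonneg hμ.le p4, mul_nonneg hμ.le p2,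
      mul_nonneg (add_pos hμ hl).le p4, mul_nonneg (add_pos hμ hl).le p1]
  rw [← mul_le_mul_iff_of_pos_left (pow_pos hα 2)]
  refine h4.trans ?_
  have e : S.α ^ 2 * (3 * ‖g‖ ^ 2 / S.α ^ 2 * (S.lam ^ 2 * c ^ 2 + S.μ + (S.μ + S.lam)) *
      (‖u‖ ^ 2 + 1 / S.μ * ‖r‖ ^ 2 + 1 / (S.μ + S.lam) * ‖R‖ ^ 2)) =
      ‖g‖ ^ 2 * (3 * ((S.lam ^ 2 * c ^ 2 + S.μ + (S.μ + S.lam)) *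
        (‖u‖ ^ 2 + 1 / S.μ * ‖r‖ ^ 2 + 1 / (S.μ + S.lam) * ‖R‖ ^ 2))) := by
    field_simp
  rw [e]
  gcongr

/-- The trial norm controls the components of the pressure in the direction of elements of `𝔻`. -/
theorem exists_lintegral_inner_le_normSq {g : L2 S.Ω} (hg : g ∈ S.D) :
    ∃ C : ℝ≥0∞, C ≠ ∞ ∧ ∀ y : S.Trial,
      ∫⁻ t, ‖inner ℝ g (S.pIncl (y.p t))‖ₑ ^ 2 ∂S.time ≤ C * y.normSq := by
  refine ⟨ENNReal.ofReal (3 * ‖g‖ ^ 2 / S.α ^ 2 *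
    (S.lam ^ 2 * (d / Real.sqrt (2 * S.μ)) ^ 2 + S.μ + (S.μ + S.lam))),
    ENNReal.ofReal_ne_top, fun y => ?_⟩
  set C := 3 * ‖g‖ ^ 2 / S.α ^ 2 *
    (S.lam ^ 2 * (d / Real.sqrt (2 * S.μ)) ^ 2 + S.μ + (S.μ + S.lam))
  have hμ := S.μ_pos
  have hl := S.lam_pos
  have hα := S.α_pos
  let A : ℝ → ℝ≥0∞ := fun t => ‖y.u t‖ₑ ^ 2 + ENNReal.ofReal (1 / S.μ) * ‖y.ptot t‖ₑ ^ 2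
  let B : ℝ → ℝ≥0∞ := fun t => ENNReal.ofReal (1 / (S.μ + S.lam)) *
    ‖S.lam • S.divU (y.u t) - (y.ptot t : L2 S.Ω) - S.α • S.projD (S.pIncl (y.p t))‖ₑ ^ 2
  have hA : AEMeasurable A S.time :=
    (aemeasurable_enorm_sq y.memLp_u).add ((aemeasurable_enorm_sq y.memLp_ptot).const_mul _)
  have hpt : ∀ t, ‖inner ℝ g (S.pIncl (y.p t))‖ₑ ^ 2 ≤ ENNReal.ofReal C * (A t + B t) := by
    intro t
    have h := inner_sq_le_of_mem_D hg (y.u t) (y.ptot t : L2 S.Ω) (S.pIncl (y.p t))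
    have e : A t + B t = ENNReal.ofReal (‖y.u t‖ ^ 2 + 1 / S.μ * ‖(y.ptot t : L2 S.Ω)‖ ^ 2 +
        1 / (S.μ + S.lam) * ‖S.lam • S.divU (y.u t) - (y.ptot t : L2 S.Ω)
          - S.α • S.projD (S.pIncl (y.p t))‖ ^ 2) := by
      simp only [A, B, enorm_sq_eq_ofReal]
      rw [ENNReal.ofReal_add (by positivity) (by positivity),
        ENNReal.ofReal_add (by positivity) (by positivity),
        ENNReal.ofReal_mul (by positivity), ENNReal.ofReal_mul (by positivity)]
      rfl
    rw [e, ← ENNReal.ofReal_mul (by positivity), enorm_sq_eq_ofReal, Real.norm_eq_abs, sq_abs]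
    exact ENNReal.ofReal_le_ofReal h
  calc ∫⁻ t, ‖inner ℝ g (S.pIncl (y.p t))‖ₑ ^ 2 ∂S.time
      ≤ ∫⁻ t, ENNReal.ofReal C * (A t + B t) ∂S.time := lintegral_mono hpt
    _ = ENNReal.ofReal C * ((∫⁻ t, A t ∂S.time) + ∫⁻ t, B t ∂S.time) := by
        -- Measurability of one summand suffices; `B` contains `pIncl`, whose continuity on `ℙ`
        -- would be the Poincaré inequality.
        rw [lintegral_const_mul' _ _ ENNReal.ofReal_ne_top, lintegral_add_left' hA]
    _ ≤ ENNReal.ofReal C * y.normSq := by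
        gcongr
        exact add_le_add ((lintegral_mono fun t => le_self_add).trans le_self_add)
          (lintegral_mono fun t => le_self_add)

end Data

namespace Data

variable {d : ℕ}

/-! ### Time-harmonic trial functions -/

/-- A pressure `p` with `ℒ p = -m` for some `m` in `𝔻` and in the closure of `ℙ`, together with a
frequency. -/
structure Mode (S : Data d) where
  p : S.P
  m : S.Pbar
  freq : ℝ
  freq_ne : freq ≠ 0
  inner_eq : ∀ q, inner ℝ p q = -inner ℝ (m : L2 S.Ω) (S.pIncl q)
  mem_D : (m : L2 S.Ω) ∈ S.D

variable {S : Data d}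

theorem memLp_time_of_continuous {E : Type*} [SeminormedAddCommGroup E] {f : ℝ → E}
    (hf : Continuous f) : MemLp f 2 S.time := by
  obtain ⟨C, hC⟩ := (isCompact_Icc (a := 0) (b := S.T)).exists_bound_of_continuousOn
    hf.continuousOn
  have : IsFiniteMeasure S.time := ⟨by simp [time]⟩
  have hC' : ∀ᵐ t ∂S.time, ‖‖f t‖‖ ≤ C :=
    (ae_restrict_iff' measurableSet_Ioo).2
      (Eventually.of_forall fun t ht => (norm_norm _).trans_le (hC t (Ioo_subset_Icc_self ht)))
  have h := MemLp.of_bound (p := 2) (continuous_norm.comp hf).aestronglyMeasurable C hC'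
  refine ⟨hf.aestronglyMeasurable, lt_of_le_of_lt (eLpNorm_mono_enorm fun t => ?_) h.2⟩
  exact (enorm_norm (f t)).ge

theorem integral_deriv_mul_time {φ F f : ℝ → ℝ} (h1 : ContDiff ℝ (⊤ : ℕ∞) φ)
    (h2 : HasCompactSupport φ) (h3 : tsupport φ ⊆ Ioo 0 S.T) (hF : ∀ t, HasDerivAt F (f t) t)
    (hf : Continuous f) :
    ∫ t, deriv φ t * F t ∂S.time = -∫ t, φ t * f t ∂S.time := by
  have hFc : Continuous F := continuous_iff_continuousAt.2 fun t => (hF t).continuousAt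
  have hd : Continuous (deriv φ) := h1.continuous_deriv (by simp)
  have hφ0 : ∀ t, t ∉ Ioo 0 S.T → φ t = 0 := fun t ht =>
    image_eq_zero_of_notMem_tsupport fun h => ht (h3 h)
  have hd0 : ∀ t, t ∉ Ioo 0 S.T → deriv φ t = 0 := fun t ht =>
    image_eq_zero_of_notMem_tsupport fun h => ht (h3 (tsupport_deriv_subset h))
  unfold time
  rw [setIntegral_eq_integral_of_forall_compl_eq_zero fun t ht => by rw [hd0 t ht, zero_mul],
    setIntegral_eq_integral_of_forall_compl_eq_zero fun t ht => by rw [hφ0 t ht, zero_mul],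
    integral_mul_deriv_eq_deriv_mul_of_integrable
      (fun t _ => (h1.differentiable (by simp) t).hasDerivAt) (fun t _ => hF t), neg_neg]
  · exact (h1.continuous.mul hf).integrable_of_hasCompactSupport h2.mul_right
  · exact (hd.mul hFc).integrable_of_hasCompactSupport h2.deriv.mul_right
  · exact (h1.continuous.mul hFc).integrable_of_hasCompactSupport h2.mul_right

theorem Mode.hasDerivAt (c : S.Mode) (t : ℝ) :
    HasDerivAt (fun t => Real.sin (c.freq * t) / c.freq) (Real.cos (c.freq * t)) t := by
  have h : HasDerivAt (fun t => c.freq * t) c.freq t := by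
    simpa using (hasDerivAt_id t).const_mul c.freq
  have := (h.sin).div_const c.freq
  rwa [mul_div_assoc, div_self c.freq_ne, mul_one] at this

/-- The trial function `u = 0`, `p_tot = 0`, `p = ∑ⱼ cos(ωⱼ t) pⱼ`, `m = -∫₀ᵗ ℒ p`. -/
def oscillation (c : ℕ → S.Mode) (J : Finset ℕ) : S.Trial where
  u _ := 0
  ptot _ := 0
  p t := ∑ j ∈ J, Real.cos ((c j).freq * t) • (c j).p
  m t := ∑ j ∈ J, (Real.sin ((c j).freq * t) / (c j).freq) • (c j).m
  mc t := -∑ j ∈ J, (Real.sin ((c j).freq * t) / (c j).freq) • S.diffusion (c j).p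
  dm t := -∑ j ∈ J, Real.cos ((c j).freq * t) • S.diffusion (c j).p
  memLp_u := memLp_time_of_continuous continuous_const
  memLp_ptot := memLp_time_of_continuous continuous_const
  memLp_p := memLp_time_of_continuous (by fun_prop)
  memLp_m := memLp_time_of_continuous (by fun_prop)
  memLp_dm := memLp_time_of_continuous (by fun_prop)
  continuousOn_mc := Continuous.continuousOn (by fun_prop)
  -- The relation `ℒ pⱼ = -mⱼ` of each mode identifies the functional with the `L²(Ω)` pairing.
  mc_eq := Eventually.of_forall fun t n => by
    simp only [neg_apply, sum_apply, smul_apply, AddSubmonoidClass.coe_finsetSum,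
      SetLike.val_smul, sum_inner, inner_smul_left, ← inner_eq_diffusion, (c _).inner_eq n]
    simp
  isWeakTimeDeriv := by
    intro φ h1 h2 h3 n
    refine integral_deriv_mul_time h1 h2 h3 (fun t => ?_) ?_
    · simp only [neg_apply, sum_apply, smul_apply, smul_eq_mul]
      exact (HasDerivAt.fun_sum fun j _ => ((c j).hasDerivAt t).mul_const _).neg
    · simp only [neg_apply, sum_apply, smul_apply, smul_eq_mul]
      fun_prop

/-! ### Upper bound for the trial norm -/

theorem enorm_sq_eq_zero {E : Type*} [SeminormedAddGroup E] {x : E} (hx : x = 0) :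
    ‖x‖ₑ ^ 2 = 0 := by
  rw [enorm_sq_eq_ofReal, hx, norm_zero]
  simp

/-- The trial norm of a homogeneous solution with small pressure and fluid content. -/
theorem exists_normSq_le (S : Data d) : ∃ K : ℝ≥0∞, K ≠ ∞ ∧ ∀ (y : S.Trial) (ε : ℝ),
    (∀ t, y.u t = 0) → (∀ t, y.ptot t = 0) → (∀ t, y.dm t = -S.diffusion (y.p t)) →
    y.mc 0 = 0 → (∀ t, ‖S.pIncl (y.p t)‖ ≤ ε) → (∀ t, ‖y.m t‖ ≤ ε) →
    y.normSq ≤ K * ENNReal.ofReal (ε ^ 2) := by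
  have hα := S.α_pos
  have hσ := S.σ_nonneg
  set K₀ : ℝ≥0∞ := ENNReal.ofReal (1 / (S.μ + S.lam)) * ENNReal.ofReal (S.α ^ 2) +
    ENNReal.ofReal S.gam * ENNReal.ofReal ((S.σ + 1) ^ 2) with hK₀
  refine ⟨K₀ * ENNReal.ofReal S.T, by finiteness, fun y ε hu hr hm h0 hp hme => ?_⟩
  have hε : 0 ≤ ε := (norm_nonneg _).trans (hp 0)
  have e1 : ∀ t, ‖y.u t‖ₑ ^ 2 + ENNReal.ofReal (1 / S.μ) * ‖y.ptot t‖ₑ ^ 2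
      + ‖y.dm t + S.diffusion (y.p t)‖ₑ ^ 2 = 0 := fun t => by
    have h1 : ‖y.dm t + S.diffusion (y.p t)‖ₑ ^ 2 = 0 := 
      enorm_sq_eq_zero (by rw [hm t, neg_add_cancel])
    rw [h1, enorm_sq_eq_zero (hu t), enorm_sq_eq_zero (hr t), mul_zero, add_zero, add_zero]
  have hb : ∀ {E : Type _} [SeminormedAddCommGroup E] (x : E) (a : ℝ), ‖x‖ ≤ a * ε →
      ‖x‖ₑ ^ 2 ≤ ENNReal.ofReal (a ^ 2) * ENNReal.ofReal (ε ^ 2) := fun x a hx => by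
    rw [enorm_sq_eq_ofReal, ← ENNReal.ofReal_mul (sq_nonneg _), ← mul_pow]
    exact ENNReal.ofReal_le_ofReal (pow_le_pow_left₀ (norm_nonneg _) hx 2)
  have e2 : ∀ t, ENNReal.ofReal (1 / (S.μ + S.lam)) *
          ‖S.lam • S.divU (y.u t) - (y.ptot t : L2 S.Ω) - S.α • S.projD (S.pIncl (y.p t))‖ₑ ^ 2
        + ENNReal.ofReal S.gam *
          ‖S.α • S.projPbar (S.divU (y.u t)) + S.σ • S.pIncl (y.p t) - (y.m t : L2 S.Ω)‖ₑ ^ 2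
        ≤ K₀ * ENNReal.ofReal (ε ^ 2) := fun t => by
    rw [hK₀, add_mul, mul_assoc, mul_assoc]
    refine add_le_add (mul_le_mul_right (hb _ _ ?_) _) (mul_le_mul_right (hb _ _ ?_) _)
    · rw [hu t, hr t]
      simp only [map_zero, smul_zero, ZeroMemClass.coe_zero, sub_zero, zero_sub, norm_neg]
      rw [norm_smul, Real.norm_of_nonneg hα.le]
      gcongr
      exact (Submodule.norm_starProjection_apply_le _ _).trans (hp t)
    · rw [hu t]
      simp only [map_zero, smul_zero, zero_add]
      refine (norm_sub_le _ _).trans ?_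
      rw [norm_smul, Real.norm_of_nonneg hσ, add_mul, one_mul]
      exact add_le_add (mul_le_mul_of_nonneg_left (hp t) hσ) (hme t)
  have e3 : ‖y.mc 0‖ₑ ^ 2 = 0 := enorm_sq_eq_zero h0
  unfold Trial.normSq
  simp only [e1, lintegral_zero, e3, zero_add]
  refine (lintegral_mono e2).trans (le_of_eq ?_)
  rw [lintegral_const]
  simp only [time, MeasurableSet.univ, Measure.restrict_apply, univ_inter, Real.volume_Ioo,
    sub_zero]
  ring

/-! ### Construction of the modes -/

/-- Pairwise orthogonal modes that are small in `L²(Ω)` and large in `ℙ`. -/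
structure IsSpreading (c : ℕ → S.Mode) : Prop where
  orthogonal : ∀ j k, j ≠ k → inner ℝ (c j).p (c k).p = 0
  norm_p_le : ∀ j, ‖S.pIncl (c j).p‖ ≤ (1 / 2) ^ j
  norm_m_le : ∀ j t, ‖(Real.sin ((c j).freq * t) / (c j).freq) • (c j).m‖ ≤ (1 / 2) ^ j
  le_norm_sq : ∀ j : ℕ, (j : ℝ) + 1 ≤ ‖(c j).p‖ ^ 2
  integral_cos_sq : ∀ j, ∫ t in 0..S.T, Real.cos ((c j).freq * t) ^ 2 = S.T / 2

theorem exists_isSpreading (hd : 0 < d) (S : Data d) : ∃ c : ℕ → S.Mode, IsSpreading c := by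
  have hT := S.T_pos
  have hκ := S.κ_pos
  let i₀ : Fin d := ⟨0, hd⟩
  have : Nonempty (Fin d) := ⟨i₀⟩
  -- A nonempty open set in positive dimension is infinite, and an infinite Hausdorff space contains
  -- a sequence of pairwise disjoint nonempty open sets.
  have : Infinite S.Ω := by
    obtain ⟨x, hx⟩ := S.isConnected.nonempty
    exact (infinite_of_mem_nhds x (S.isOpen.mem_nhds hx)).to_subtype
  obtain ⟨U, hU1, hU2, hU3⟩ := exists_seq_infinite_isOpen_pairwise_disjoint S.Ω
  let V : ℕ → Set (Space d) := fun j => Subtype.val '' U j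
  have hV : ∀ j, IsOpen (V j) := fun j => S.isOpen.isOpenMap_subtype_val _ (hU2 j)
  have hVΩ : ∀ j, V j ⊆ S.Ω := fun j => Subtype.coe_image_subset _ _
  have hVd : ∀ j k, j ≠ k → Disjoint (V j) (V k) := fun j k hjk =>
    (disjoint_image_iff Subtype.val_injective).2 (hU3 hjk)
  choose ψ hψV hψ1 hψ2 using fun j : ℕ => exists_isTestFunction_pd_small i₀ (hV j)
    ((hU1 j).nonempty.image _) (ε := ((1 / 2) ^ j) ^ 2) (by positivity) (((j : ℝ) + 1) / S.κ)
  have hψ : ∀ j, IsTestFunction S.Ω (ψ j) := fun j => (hψV j).mono (hVΩ j)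
  let m : ℕ → S.Pbar := fun j =>
    ⟨S.κ • laplacian ((hψ j).pd i₀), Submodule.smul_mem _ _ (laplacian_mem_Pbar _)⟩
  -- The frequency is a multiple of `π / T`, so that `cos²` has mean exactly `1 / 2` on `(0, T)`,
  -- and large enough to make `‖m j‖` divided by it at most `2⁻ʲ`.
  have hN : ∀ j, ∃ N : ℕ, 0 < N ∧ ‖m j‖ / (1 / 2) ^ j ≤ Real.pi * N / S.T := fun j => by
    obtain ⟨N, hN⟩ := exists_nat_ge (‖m j‖ / (1 / 2) ^ j * S.T / Real.pi)
    refine ⟨N + 1, N.succ_pos, ?_⟩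
    rw [div_le_iff₀ Real.pi_pos] at hN
    rw [le_div_iff₀ hT]
    push_cast
    nlinarith [Real.pi_pos]
  choose N hN0 hN1 using hN
  have hfreq : ∀ j, 0 < Real.pi * N j / S.T := fun j => by
    have : (0 : ℝ) < N j := Nat.cast_pos.2 (hN0 j)
    have := Real.pi_pos
    positivity
  let c : ℕ → S.Mode := fun j =>
    { p := pressureOfPd (hψ j) i₀
      m := m j
      freq := Real.pi * N j / S.T
      freq_ne := (hfreq j).ne'
      inner_eq := inner_pressureOfPd (hψ j) i₀
      mem_D := Submodule.smul_mem _ _ (laplacian_mem_D _) }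
  refine ⟨c, fun j k hjk => ?_, fun j => ?_, fun j t => ?_, fun j => ?_, fun j => ?_⟩
  · exact inner_pressureOfPd_of_disjoint (hVd j k hjk) (hψ j) (hψ k) (hψV j) (hψV k) i₀
  · refine le_of_sq_le_sq ?_ (by positivity)
    exact (norm_sq_pIncl_pressureOfPd (hψ j) i₀).trans_le (hψ1 j)
  · rw [norm_smul, norm_div, Real.norm_of_nonneg (hfreq j).le, div_mul_eq_mul_div,
      div_le_iff₀ (hfreq j)]
    have h1 := hN1 j
    rw [div_le_iff₀ (by positivity), mul_comm] at h1
    exact (mul_le_of_le_one_left (norm_nonneg _) (Real.abs_sin_le_one _)).trans h1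
  · refine le_trans ?_ (le_norm_sq_pressureOfPd (hψ j) i₀)
    have := hψ2 j
    rw [div_le_iff₀ hκ] at this
    linarith
  · have h1 := intervalIntegral.integral_comp_mul_left (a := 0) (b := S.T)
      (fun x => Real.cos x ^ 2) (c j).freq_ne
    rw [h1, integral_cos_sq]
    have h2 : (c j).freq * S.T = N j * Real.pi := by
      change Real.pi * N j / S.T * S.T = _
      field_simp
    have h3 := (c j).freq_ne
    rw [h2, Real.sin_nat_mul_pi]
    simp only [mul_zero, Real.sin_zero, sub_self, zero_add, sub_zero, smul_eq_mul]
    rw [← h2]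
    field_simp

/-! ### Components of the oscillations, and their Cauchy property -/

theorem IsSpreading.lintegral_cos_sq {c : ℕ → S.Mode} (hc : IsSpreading c) (j : ℕ) :
    ∫⁻ t, ‖Real.cos ((c j).freq * t)‖ₑ ^ 2 ∂S.time = ENNReal.ofReal (S.T / 2) := by
  rw [← hc.integral_cos_sq j, intervalIntegral.integral_of_le S.T_pos.le,
    integral_Ioc_eq_integral_Ioo, ofReal_integral_eq_lintegral_ofReal]
  · simp only [enorm_sq_eq_ofReal, Real.norm_eq_abs, sq_abs]
    rfl
  · exact (Continuous.integrableOn_Icc (by fun_prop)).mono_set Ioo_subset_Icc_self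
  · exact Eventually.of_forall fun t => sq_nonneg _

theorem IsSpreading.norm_ne_zero {c : ℕ → S.Mode} (hc : IsSpreading c) (j : ℕ) :
    ‖(c j).p‖ ≠ 0 := fun h => by
  have := hc.le_norm_sq j
  rw [h] at this
  have : (0 : ℝ) ≤ j := j.cast_nonneg
  norm_num at *
  linarith

theorem IsSpreading.inner_oscillation_p {c : ℕ → S.Mode} (hc : IsSpreading c) {J : Finset ℕ}
    {j : ℕ} (hj : j ∈ J) (t : ℝ) : inner ℝ (c j).p ((oscillation c J).p t) =
      Real.cos ((c j).freq * t) * ‖(c j).p‖ ^ 2 := by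
  change inner ℝ (c j).p (∑ k ∈ J, Real.cos ((c k).freq * t) • (c k).p) = _
  rw [inner_sum, Finset.sum_eq_single j]
  · rw [inner_smul_right, real_inner_self_eq_norm_sq]
  · intro k _ hk
    rw [inner_smul_right, hc.orthogonal j k hk.symm, mul_zero]
  · exact fun h => absurd hj h

theorem dm_oscillation (c : ℕ → S.Mode) (J : Finset ℕ) (t : ℝ) :
    (oscillation c J).dm t = -S.diffusion ((oscillation c J).p t) := by
  simp [oscillation]

theorem mc_oscillation_zero (c : ℕ → S.Mode) (J : Finset ℕ) : (oscillation c J).mc 0 = 0 := by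
  simp [oscillation]

theorem norm_sum_range_sub_le {E : Type*} [SeminormedAddCommGroup E] {v : ℕ → E}
    (hv : ∀ j, ‖v j‖ ≤ (1 / 2) ^ j) {N k l : ℕ} (hk : N ≤ k) (hl : N ≤ l) :
    ‖∑ j ∈ Finset.range k, v j - ∑ j ∈ Finset.range l, v j‖ ≤ 2 * (1 / 2) ^ N := by
  wlog h : l ≤ k generalizing k l
  · rw [norm_sub_rev]
    exact this hl hk (le_of_not_ge h)
  rw [← Finset.sum_Ico_eq_sub _ h]
  refine (norm_sum_le_of_le _ fun j _ => hv j).trans ?_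
  have h1 : ∀ n, ∑ j ∈ Finset.range n, (1 / 2 : ℝ) ^ j = 2 - 2 * (1 / 2) ^ n := fun n => by
    rw [geom_sum_eq (by norm_num)]
    ring
  rw [Finset.sum_Ico_eq_sub _ h, h1, h1]
  have h2 : (1 / 2 : ℝ) ^ l ≤ (1 / 2) ^ N := pow_le_pow_of_le_one (by norm_num) (by norm_num) hl
  have h3 : (0 : ℝ) ≤ (1 / 2) ^ k := by positivity
  linarith

theorem IsSpreading.norm_cos_smul_le {c : ℕ → S.Mode} (hc : IsSpreading c) (j : ℕ) (t : ℝ) :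
    ‖Real.cos ((c j).freq * t) • S.pIncl (c j).p‖ ≤ (1 / 2) ^ j := by
  rw [norm_smul]
  exact (mul_le_of_le_one_left (norm_nonneg _) (Real.abs_cos_le_one _)).trans (hc.norm_p_le j)

/-- Differences of partial sums are again homogeneous solutions, and their pressure and fluid
content are tails of a geometric series, uniformly in time. -/
theorem exists_normSq_oscillation_sub_le (S : Data d) : ∃ K : ℝ≥0∞, K ≠ ∞ ∧
    ∀ c : ℕ → S.Mode, IsSpreading c → ∀ N k l : ℕ, N ≤ k → N ≤ l →
      (oscillation c (Finset.range k) - oscillation c (Finset.range l)).normSq ≤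
        K * ENNReal.ofReal ((2 * (1 / 2) ^ N) ^ 2) := by
  obtain ⟨K, hK, h⟩ := S.exists_normSq_le
  refine ⟨K, hK, fun c hc N k l hk hl => h _ _ (fun t => ?_) (fun t => ?_) (fun t => ?_) ?_
    (fun t => ?_) fun t => ?_⟩
  · exact sub_self (0 : S.U)
  · exact sub_self (0 : S.D)
  · change (oscillation c _).dm t - (oscillation c _).dm t =
      -S.diffusion ((oscillation c _).p t - (oscillation c _).p t)
    rw [dm_oscillation, dm_oscillation, map_sub]
    abel
  · change (oscillation c _).mc 0 - (oscillation c _).mc 0 = 0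
    rw [mc_oscillation_zero, mc_oscillation_zero, sub_zero]
  · change ‖S.pIncl (∑ j ∈ Finset.range k, Real.cos ((c j).freq * t) • (c j).p -
      ∑ j ∈ Finset.range l, Real.cos ((c j).freq * t) • (c j).p)‖ ≤ _
    simp only [map_sub, map_sum, map_smul]
    exact norm_sum_range_sub_le (fun j => hc.norm_cos_smul_le j t) hk hl
  · exact norm_sum_range_sub_le (fun j => hc.norm_m_le j t) hk hl

theorem exists_normSq_oscillation_singleton_le (S : Data d) : ∃ K : ℝ≥0∞, K ≠ ∞ ∧
    ∀ c : ℕ → S.Mode, IsSpreading c → ∀ j : ℕ, (oscillation c {j}).normSq ≤ K := by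
  obtain ⟨K, hK, h⟩ := S.exists_normSq_le
  refine ⟨K * ENNReal.ofReal (1 ^ 2), by finiteness, fun c hc j => h _ _ (fun t => rfl)
    (fun t => rfl) (dm_oscillation c _) (mc_oscillation_zero c _) (fun t => ?_) fun t => ?_⟩
  · change ‖S.pIncl (∑ k ∈ {j}, Real.cos ((c k).freq * t) • (c k).p)‖ ≤ _
    rw [Finset.sum_singleton, map_smul]
    exact (hc.norm_cos_smul_le j t).trans (pow_le_one₀ (by norm_num) (by norm_num))
  · change ‖∑ k ∈ {j}, (Real.sin ((c k).freq * t) / (c k).freq) • (c k).m‖ ≤ _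
    rw [Finset.sum_singleton]
    exact (hc.norm_m_le j t).trans (pow_le_one₀ (by norm_num) (by norm_num))

/-! ### Unbounded quotient and missing limit -/

theorem Mode.exists_lintegral_inner_le (c : S.Mode) : ∃ C : ℝ≥0∞, C ≠ ∞ ∧ ∀ y : S.Trial,
    ∫⁻ t, ‖inner ℝ c.p (y.p t)‖ₑ ^ 2 ∂S.time ≤ C * y.normSq := by
  obtain ⟨C, hC, h⟩ := exists_lintegral_inner_le_normSq c.mem_D
  refine ⟨C, hC, fun y => le_trans (le_of_eq ?_) (h y)⟩
  simp only [c.inner_eq, enorm_neg]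

/-- Cauchy-Schwarz gives `|cos| ‖pⱼ‖ ≤ ‖p(t)‖`; square and integrate. Only the component along `pⱼ`
matters, so this applies to single modes and to a hypothetical limit alike. -/
theorem IsSpreading.le_lintegral_of_norm_le {c : ℕ → S.Mode} (hc : IsSpreading c) (j : ℕ)
    {p : ℝ → S.P} (hp : ∀ᵐ t ∂S.time, inner ℝ (c j).p (p t) =
      Real.cos ((c j).freq * t) * ‖(c j).p‖ ^ 2) :
    ENNReal.ofReal (((j : ℝ) + 1) * (S.T / 2)) ≤ ∫⁻ t, ‖p t‖ₑ ^ 2 ∂S.time := by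
  have h0 : 0 < ‖(c j).p‖ := lt_of_le_of_ne (norm_nonneg _) (hc.norm_ne_zero j).symm
  rw [ENNReal.ofReal_mul (by positivity), ← hc.lintegral_cos_sq j,
    ← lintegral_const_mul' _ _ ENNReal.ofReal_ne_top]
  refine lintegral_mono_ae (hp.mono fun t ht => ?_)
  rw [enorm_sq_eq_ofReal, enorm_sq_eq_ofReal, ← ENNReal.ofReal_mul (by positivity)]
  refine ENNReal.ofReal_le_ofReal ?_
  have h1 := abs_real_inner_le_norm (c j).p (p t)
  rw [ht, abs_mul, abs_of_nonneg (sq_nonneg ‖(c j).p‖), sq, ← mul_assoc, mul_comm ‖(c j).p‖,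
    mul_le_mul_iff_of_pos_right h0] at h1
  have h2 := pow_le_pow_left₀ (by positivity) h1 2
  rw [mul_pow] at h2
  rw [Real.norm_eq_abs]
  refine le_trans ?_ h2
  rw [mul_comm]
  exact mul_le_mul_of_nonneg_left (hc.le_norm_sq j) (sq_nonneg _)

/-- A vanishing trial norm would annihilate the component along `pⱼ`, which is a nonzero multiple of
the cosine. -/
theorem IsSpreading.normSq_singleton_ne_zero {c : ℕ → S.Mode} (hc : IsSpreading c) (j : ℕ) :
    (oscillation c {j}).normSq ≠ 0 := fun h0 => by
  obtain ⟨C, hC, h⟩ := (c j).exists_lintegral_inner_le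
  have h1 := h (oscillation c {j})
  rw [h0, mul_zero, nonpos_iff_eq_zero] at h1
  simp only [hc.inner_oscillation_p (Finset.mem_singleton_self j), enorm_mul, mul_pow] at h1
  rw [lintegral_mul_const' _ _ (by finiteness), hc.lintegral_cos_sq] at h1
  rcases mul_eq_zero.1 h1 with h1 | h1
  · rw [ENNReal.ofReal_eq_zero] at h1
    linarith [S.T_pos]
  · rw [enorm_sq_eq_ofReal, ENNReal.ofReal_eq_zero] at h1
    have h2 : ‖(c j).p‖ ^ 2 = 0 := by simpa using h1.antisymm (sq_nonneg _)
    exact hc.norm_ne_zero j (pow_eq_zero_iff two_ne_zero |>.1 h2)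

theorem iSup_roughEnergy_div_normSq (hd : 0 < d) (S : Data d) :
    (⨆ (y : S.Trial) (_ : y.normSq ≠ 0), y.roughEnergy / y.normSq) = ⊤ := by
  obtain ⟨c, hc⟩ := exists_isSpreading hd S
  obtain ⟨K, hK, h⟩ := S.exists_normSq_oscillation_singleton_le
  have hlim : Tendsto (fun j : ℕ => ENNReal.ofReal (((j : ℝ) + 1) * (S.T / 2)) / K)
      atTop (𝓝 ⊤) := by
    have h1 : Tendsto (fun j : ℕ => ENNReal.ofReal (((j : ℝ) + 1) * (S.T / 2))) atTop (𝓝 ⊤) :=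
      ENNReal.tendsto_ofReal_atTop.comp
        ((tendsto_atTop_add_const_right _ _ tendsto_natCast_atTop_atTop).atTop_mul_const
          (half_pos S.T_pos))
    have h2 := ENNReal.Tendsto.div_const (b := K) h1 (Or.inl ENNReal.top_ne_zero)
    rwa [ENNReal.top_div_of_ne_top hK] at h2
  refine top_unique (le_of_tendsto' hlim fun j => ?_)
  refine le_trans ?_ (le_iSup₂_of_le (oscillation c {j}) (hc.normSq_singleton_ne_zero j) le_rfl)
  refine ENNReal.div_le_div ?_ (h c hc j)
  refine (hc.le_lintegral_of_norm_le j (Eventually.of_forall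
    (hc.inner_oscillation_p (Finset.mem_singleton_self j)))).trans ?_
  exact lintegral_mono fun t => le_add_self

theorem IsSpreading.not_tendsto {c : ℕ → S.Mode} (hc : IsSpreading c) (z : S.Trial) :
    ¬ Tendsto (fun k => (oscillation c (Finset.range k) - z).normSq) atTop (𝓝 0) := fun hz => by
  have key : ∀ j, ∀ᵐ t ∂S.time, inner ℝ (c j).p (z.p t) =
      Real.cos ((c j).freq * t) * ‖(c j).p‖ ^ 2 := by
    intro j
    obtain ⟨C, hC, h⟩ := (c j).exists_lintegral_inner_le
    let f : ℝ → ℝ := fun t =>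
      Real.cos ((c j).freq * t) * ‖(c j).p‖ ^ 2 - inner ℝ (c j).p (z.p t)
    have h1 : ∫⁻ t, ‖f t‖ₑ ^ 2 ∂S.time = 0 := by
      have h2 : Tendsto (fun k => C * (oscillation c (Finset.range k) - z).normSq) atTop (𝓝 0) := by
        simpa using ENNReal.Tendsto.const_mul hz (Or.inr hC)
      -- For `k > j` the component of the partial sum along `pⱼ` no longer depends on `k`, so the
      -- fixed integral is bounded by a null sequence.
      refine nonpos_iff_eq_zero.1 (ge_of_tendsto h2 ?_)
      filter_upwards [eventually_gt_atTop j] with k hk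
      refine le_trans (le_of_eq (lintegral_congr fun t => ?_)) (h _)
      change _ = ‖inner ℝ (c j).p ((oscillation c (Finset.range k)).p t - z.p t)‖ₑ ^ 2
      rw [inner_sub_right, hc.inner_oscillation_p (Finset.mem_range.2 hk)]
    have hm : AEMeasurable (fun t => ‖f t‖ₑ ^ 2) S.time := by
      have h3 : AEStronglyMeasurable (fun t => S.diffusion (c j).p (z.p t)) S.time :=
        (S.diffusion (c j).p).continuous.comp_aestronglyMeasurable z.memLp_p.1
      have h4 : AEStronglyMeasurable f S.time :=
        (Continuous.aestronglyMeasurable (by fun_prop)).sub h3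
      exact h4.enorm.pow_const 2
    filter_upwards [(lintegral_eq_zero_iff' hm).1 h1] with t ht
    have : f t = 0 := by simpa using ht
    linarith [sub_eq_zero.1 this]
  have hfin : ∫⁻ t, ‖z.p t‖ₑ ^ 2 ∂S.time < ⊤ := by
    have := lintegral_rpow_enorm_lt_top_of_eLpNorm_lt_top two_ne_zero ENNReal.ofNat_ne_top
      z.memLp_p.2
    simpa using this
  -- A single mode with large enough index already exceeds the finite energy of the limit.
  obtain ⟨j, hj⟩ := exists_nat_gt ((∫⁻ t, ‖z.p t‖ₑ ^ 2 ∂S.time).toReal / (S.T / 2))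
  have h1 := hc.le_lintegral_of_norm_le j (key j)
  rw [ENNReal.ofReal_le_iff_le_toReal hfin.ne] at h1
  have hT := S.T_pos
  rw [div_lt_iff₀ (half_pos hT)] at hj
  linarith

end Data

end Biot

end

theorem proposition4p4 {d : ℕ} (hd : 0 < d) (S : Biot.Data d) :
    -- the supremum over the trial space of the quotient is infinite
    (⨆ (y : S.Trial) (_ : y.normSq ≠ 0), y.roughEnergy / y.normSq) = ⊤ ∧
    -- some Cauchy sequence in the trial space has no limit in the trial space
    ∃ y : ℕ → S.Trial,
      (∀ ε : ENNReal, 0 < ε → ∃ N : ℕ, ∀ k ≥ N, ∀ l ≥ N, (y k - y l).normSq < ε) ∧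
      ∀ z : S.Trial, ¬ Filter.Tendsto (fun k => (y k - z).normSq) Filter.atTop (nhds 0) := by
  refine ⟨Biot.Data.iSup_roughEnergy_div_normSq hd S, ?_⟩
  obtain ⟨c, hc⟩ := Biot.Data.exists_isSpreading hd S
  obtain ⟨K, hK, h⟩ := S.exists_normSq_oscillation_sub_le
  refine ⟨fun k => Biot.Data.oscillation c (Finset.range k), fun ε hε => ?_, hc.not_tendsto⟩
  have hlim : Tendsto (fun N : ℕ => K * ENNReal.ofReal ((2 * (1 / 2 : ℝ) ^ N) ^ 2))
      atTop (𝓝 0) := by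
    have h1 : Tendsto (fun N : ℕ => (2 * (1 / 2 : ℝ) ^ N) ^ 2) atTop (𝓝 0) := by
      simpa using ((tendsto_pow_atTop_nhds_zero_of_lt_one (r := (1 / 2 : ℝ)) (by norm_num)
        (by norm_num)).const_mul 2).pow 2
    simpa using ENNReal.Tendsto.const_mul (ENNReal.tendsto_ofReal h1) (Or.inr hK)
  obtain ⟨N, hN⟩ := ((tendsto_order.1 hlim).2 ε hε).exists
  exact ⟨N, fun k hk l hl => (h c hc N k l hk hl).trans_lt hN⟩
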